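/- Let $\mathcal M$ be a von Neumann algebra with a normal faithful tracial state $\tau$. Let $L_1(\mathcal M)$ be the completion of $\mathcal M$ for $\|x\|_1=\tau(|x|)$ (the predual of $\mathcal M$) and $L_2(\mathcal M)$ the completion for $\|x\|_2=\tau(x^*x)^{1/2}$. For a family $(f_i)_{i\in I}$ in $L_1(\mathcal M)$ put $$\|(f_i)_{i\in I}\|_{L_1[\ell_\infty]}=\inf\Big\{\|\alpha\|_2\,\sup_{i}\|h_i\|_\infty\,\|\beta\|_2\;:\; f_i=\alpha h_i\beta \text{ for all } i,\ \alpha,\beta\in L_2(\mathcal M),\ (h_i)_i \text{ bounded in } \mathcal M\Big\}\in[0,\infty],$$ and for a double sequence $(f_{n,m})$ in $L_1(\mathcal M)$ put $$\Big\|{\limsup_{n,m\to\infty}}^{+} f_{n,m}\Big\|_1=\sup_{\varepsilon>0}\ \inf_{e}\ \inf_{N,K}\ \big\|(e^\perp f_{n,m}e^\perp)_{n>N,\,m>K}\big\|_{L_1[\ell_\infty]},$$ where $e$ runs through the projections of $\mathcal M$ with $\tau(e)<\varepsilon$ and $e^\perp=1-e$. A sequence $f_n$ converges to $f$ bilaterally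 almost uniformly (b.a.u.) if for every $\varepsilon>0$ there is a projection $e\in\mathcal M$ with $\tau(e)<\varepsilon$ and $\|e^\perp(f_n-f)e^\perp\|_\infty\to0$. Let $\Phi:[0,\infty)\to[0,\infty)$ be convex and increasing with $\Phi(0)=0$ and $\lim_{t\to\infty}\Phi(t)=\infty$, and let $L_\Phi(\mathcal M)\subset L_1(\mathcal M)$ be the Orlicz space with norm $\|f\|_\Phi=\inf\{\lambda>0:\tau(\Phi(|f|/\lambda))\le1\}$. Let $(A_n)_{n}$ and $(B_m)_{m}$ be sequences of positivity-preserving linear maps on $L_1(\mathcal M)$ such that (i) $\|(B_m)_m: L_\Phi(\mathcal M)\to L_1(\mathcal M;\ell_\infty)\|<\infty$, this norm being the least constant $C$ with $\|(B_m(f))_m\|_{L_1[\ell_\infty]}\le C\|f\|_\Phi$ for all $f\in L_\Phi(\mathcal M)$; (ii) there is a bounded linear map $F: L_1(\mathcal M)\to L_1(\mathcal M)$ such that $A_n(f)\to F(f)$ b.a.u. for every $f\in L_1(\mathcal M)$. Then for every self-adjoint $f\in L_\Phi(\mathcal M)$, in particular for every $f\ge 0$ in $L_\Phi(\mathcal M)$,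 $$\Big\|{\limsup_{n,m\to\infty}}^{+} A_n\circ B_m(f)\Big\|_1\le\|F\|\;\big\|(B_m)_m:L_\Phi(\mathcal M)\to L_1(\mathcal M;\ell_\infty)\big\|\;\|f\|_\Phi ,$$ and for an arbitrary $f=g+ih\in L_\Phi(\mathcal M)$, where $g,h\in L_\Phi(\mathcal M)$ are its self-adjoint real and imaginary parts, the same inequality holds with $\|f\|_\Phi$ replaced by $\|g\|_\Phi+\|h\|_\Phi$. -/

import Mathlib

open scoped ENNReal NNReal ComplexOrder InnerProductSpace

noncomputable section

namespace NCIntegration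

universe u

/-! ## Concrete von Neumann algebras as C*-algebras -/

section Concrete

variable {H : Type u} [NormedAddCommGroup H] [InnerProductSpace ℂ H] [CompleteSpace H]

instance instSMulMemClass : SMulMemClass (VonNeumannAlgebra H) ℂ (H →L[ℂ] H) where
  smul_mem {S} c {_} hx := S.toStarSubalgebra.smul_mem hx c

instance instIsClosedCoe (S : VonNeumannAlgebra H) : IsClosed (S : Set (H →L[ℂ] H)) := by
  rw [← S.centralizer_centralizer]
  exact Set.isClosed_centralizer _

end Concrete

/-! ## Tracial states -/

/-- A tracial state on a unital C*-algebra. -/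
structure TracialState (M : Type u) [CStarAlgebra M] where
  /-- the underlying functional -/
  toFunctional : M →L[ℂ] ℂ
  nonneg' : ∀ x : M, 0 ≤ toFunctional (star x * x)
  one' : toFunctional 1 = 1
  comm' : ∀ x y : M, toFunctional (x * y) = toFunctional (y * x)

instance {M : Type u} [CStarAlgebra M] : CoeFun (TracialState M) (fun _ => M → ℂ) where
  coe τ := fun x => τ.toFunctional x

section General

variable {M : Type u} [CStarAlgebra M] (τ : TracialState M)

/-- The state is faithful. -/
def TracialState.IsFaithful : Prop := ∀ x : M, τ (star x * x) = 0 → x = 0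

/-- A functional `τ` on a von Neumann algebra `S` on `H` is normal if it is weak-* continuous,
i.e. if it is the restriction of a functional given by a trace class operator
`∑ᵢ |ηᵢ⟩⟨ξᵢ|` with `∑ ‖ξᵢ‖² < ∞` and `∑ ‖ηᵢ‖² < ∞`. -/
def TracialState.IsNormal {H : Type u} [NormedAddCommGroup H] [InnerProductSpace ℂ H]
    [CompleteSpace H] {S : VonNeumannAlgebra H} (τ : TracialState S) : Prop :=
  ∃ ξ η : ℕ → H, (Summable fun i => ‖ξ i‖ ^ 2) ∧ (Summable fun i => ‖η i‖ ^ 2) ∧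
    ∀ x : S, HasSum (fun i => ⟪ξ i, (x : H →L[ℂ] H) (η i)⟫_ℂ) (τ x)

/-! ## The space `L₂(M, τ)` -/

lemma TracialState.map_star (x : M) : τ (star x) = star (τ x) := by
  let _ := CStarAlgebra.spectralOrder M
  let _ := CStarAlgebra.spectralOrderedRing M
  let g : M →ₚ[ℂ] ℂ := PositiveLinearMap.mk₀ (τ.toFunctional : M →ₗ[ℂ] ℂ) (by
    intro a ha
    obtain ⟨b, rfl⟩ := CStarAlgebra.nonneg_iff_eq_star_mul_self.mp ha
    exact τ.nonneg' b)
  exact StarHomClass.map_star g x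

lemma TracialState.conj_bound (a x : M) :
    (τ (star (a * x) * (a * x))).re ≤ ‖a‖ ^ 2 * (τ (star x * x)).re := by
  let _ := CStarAlgebra.spectralOrder M
  let _ := CStarAlgebra.spectralOrderedRing M
  have h : star x * (star a * a) * x ≤ ‖star a * a‖ • (star x * x) :=
    CStarAlgebra.star_left_conjugate_le_norm_smul
  rw [← sub_nonneg] at h
  obtain ⟨b, hb⟩ := CStarAlgebra.nonneg_iff_eq_star_mul_self.mp h
  have h2 := τ.nonneg' b
  rw [← hb, map_sub, CStarRing.norm_star_mul_self, ← Complex.coe_smul, map_smul] at h2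
  have h3 := (Complex.le_def.mp h2).1
  simp only [Complex.zero_re, Complex.sub_re, smul_eq_mul, Complex.re_ofReal_mul] at h3
  have h4 : star (a * x) * (a * x) = star x * (star a * a) * x := by
    simp [mul_assoc]
  rw [h4]
  nlinarith

/-- A copy of `M`, to be equipped with the inner product `⟪a, b⟫ = τ (a* b)`. -/
def PreL2 (_τ : TracialState M) : Type u := M

instance : AddCommGroup (PreL2 τ) := inferInstanceAs (AddCommGroup M)
instance : Module ℂ (PreL2 τ) := inferInstanceAs (Module ℂ M)

/-- The identity map from `M` to `PreL2 τ`. -/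
def toPreL2 : M ≃ₗ[ℂ] PreL2 τ := LinearEquiv.refl ℂ M

/-- The inner product `⟪a, b⟫ = τ (a* b)`. -/
abbrev preL2Core : PreInnerProductSpace.Core ℂ (PreL2 τ) where
  inner a b := τ (star ((toPreL2 τ).symm a) * (toPreL2 τ).symm b)
  conj_inner_symm a b := by
    rw [← Complex.star_def, ← τ.map_star]
    simp
  re_inner_nonneg a := (Complex.le_def.mp (τ.nonneg' _)).1
  add_left a b c := by simp [add_mul]
  smul_left a b r := by simp

instance : SeminormedAddCommGroup (PreL2 τ) :=
  InnerProductSpace.Core.toSeminormedAddCommGroup (c := preL2Core τ)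

instance : InnerProductSpace ℂ (PreL2 τ) := InnerProductSpace.ofCore (preL2Core τ)

lemma preL2_norm (a : M) : ‖toPreL2 τ a‖ = √(τ (star a * a)).re := rfl

/-- `L₂(M, τ)`: the completion of `M` for the norm `‖a‖₂ = τ (a* a)^(1/2)`. -/
abbrev L2 : Type u := UniformSpace.Completion (PreL2 τ)

/-- Left multiplication by `a ∈ M` on the dense subspace `M` of `L₂(M, τ)`. -/
def preLeftMul (a : M) : PreL2 τ →L[ℂ] PreL2 τ :=
  (toPreL2 τ ∘ₗ LinearMap.mulLeft ℂ a ∘ₗ (toPreL2 τ).symm.toLinearMap : PreL2 τ →ₗ[ℂ] PreL2 τ)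
    |>.mkContinuous ‖a‖ fun x => by
      obtain ⟨x, rfl⟩ := (toPreL2 τ).surjective x
      simp only [LinearMap.coe_comp, LinearEquiv.coe_coe, Function.comp_apply,
        LinearEquiv.symm_apply_apply, LinearMap.mulLeft_apply, preL2_norm]
      rw [← Real.sqrt_sq (norm_nonneg a), ← Real.sqrt_mul (sq_nonneg _)]
      exact Real.sqrt_le_sqrt (τ.conj_bound a x)

/-- Right multiplication by `a ∈ M` on the dense subspace `M` of `L₂(M, τ)`. -/
def preRightMul (a : M) : PreL2 τ →L[ℂ] PreL2 τ :=
  (toPreL2 τ ∘ₗ LinearMap.mulRight ℂ a ∘ₗ (toPreL2 τ).symm.toLinearMap : PreL2 τ →ₗ[ℂ] PreL2 τ)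
    |>.mkContinuous ‖a‖ fun x => by
      obtain ⟨x, rfl⟩ := (toPreL2 τ).surjective x
      simp only [LinearMap.coe_comp, LinearEquiv.coe_coe, Function.comp_apply,
        LinearEquiv.symm_apply_apply, LinearMap.mulRight_apply, preL2_norm]
      rw [← Real.sqrt_sq (norm_nonneg a), ← Real.sqrt_mul (sq_nonneg _)]
      have h := τ.conj_bound (star a) (star x)
      have h1 := τ.comm' (x * a) (star (x * a))
      have h2 := τ.comm' x (star x)
      rw [← star_mul, star_star, star_star, norm_star] at h
      rw [← h1, ← h2]
      exact Real.sqrt_le_sqrt h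

/-- Left multiplication by `a ∈ M` on `L₂(M, τ)`. -/
def leftMul (a : M) : L2 τ →L[ℂ] L2 τ := (preLeftMul τ a).completion

/-- Right multiplication by `a ∈ M` on `L₂(M, τ)`. -/
def rightMul (a : M) : L2 τ →L[ℂ] L2 τ := (preRightMul τ a).completion

/-! ## The space `L₁(M, τ)` -/

/-- The embedding of `M` into its dual, `z ↦ τ (z ·)`.  The norm of `τ (z ·)` is `τ (|z|)`. -/
def embed : M →ₗ[ℂ] StrongDual ℂ M where
  toFun z := τ.toFunctional ∘L ContinuousLinearMap.mul ℂ M z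
  map_add' y z := by ext x; simp
  map_smul' c z := by ext x; simp

/-- `L₁(M, τ)`: the completion of `M` for the norm `‖z‖₁ = τ (|z|)`, realized as the closure of
`M` in its dual space, `z ∈ M` being identified with the functional `τ (z ·)`.  It is the predual
of `M`; the element `f` of `L₁(M, τ)` is the functional `x ↦ τ (f x)`. -/
def L1 : Type u := (LinearMap.range (embed τ)).topologicalClosure

instance : NormedAddCommGroup (L1 τ) :=
  inferInstanceAs (NormedAddCommGroup (LinearMap.range (embed τ)).topologicalClosure)

instance : NormedSpace ℂ (L1 τ) :=
  inferInstanceAs (NormedSpace ℂ (LinearMap.range (embed τ)).topologicalClosure)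

/-- The isometric inclusion of `L₁(M, τ)` into the dual of `M`. -/
def L1.functional : L1 τ →ₗᵢ[ℂ] StrongDual ℂ M :=
  (LinearMap.range (embed τ)).topologicalClosure.subtypeₗᵢ

variable {τ} in
/-- The functional `x ↦ τ (f x)` given by `f ∈ L₁(M, τ)`. -/
def L1.toDual (f : L1 τ) : StrongDual ℂ M := L1.functional τ f

/-- Positivity of a functional. -/
def IsPos (f : StrongDual ℂ M) : Prop := ∀ x : M, 0 ≤ f (star x * x)

variable {τ} in
/-- Self-adjointness of an element of `L₁(M, τ)`. -/
def L1.IsSA (f : L1 τ) : Prop := ∀ x : M, f.toDual (star x) = star (f.toDual x)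

/-- A linear map on `L₁(M, τ)` is positivity preserving. -/
def IsPositivityPreserving (T : L1 τ →ₗ[ℂ] L1 τ) : Prop :=
  ∀ f : L1 τ, IsPos f.toDual → IsPos (T f).toDual

/-- The compression `p f p`, i.e. the functional `x ↦ τ (p f p x) = τ (f p x p)`. -/
def compress (p : M) (f : StrongDual ℂ M) : StrongDual ℂ M :=
  f ∘L ContinuousLinearMap.mulLeftRight ℂ M p p

/-- The norm `‖f‖_∞ ∈ [0, ∞]`, infinite if `f` does not belong to `M`. -/
def normInfty (f : StrongDual ℂ M) : ℝ≥0∞ := ⨅ (z : M) (_ : f = embed τ z), ‖z‖ₑ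

/-! ## Orlicz spaces -/

/-- A convex increasing function on `[0, ∞)` with `Φ(0) = 0` and `Φ(∞) = ∞`
(the values of `Φ` on the negative numbers play no role). -/
structure IsOrlicz (Φ : ℝ → ℝ) : Prop where
  convexOn : ConvexOn ℝ (Set.Ici 0) Φ
  monotoneOn : MonotoneOn Φ (Set.Ici 0)
  map_zero : Φ 0 = 0
  tendsto : Filter.Tendsto Φ Filter.atTop Filter.atTop

/-- `ρ = |f|`: `ρ` is positive and there is a partial isometry `w ∈ M` with `f = w ρ` and
`ρ = w* f`. -/
def IsModulus (f ρ : L1 τ) : Prop :=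
  IsPos ρ.toDual ∧ ∃ w : M, w * star w * w = w ∧
    ∀ x : M, f.toDual x = ρ.toDual (x * w) ∧
      ρ.toDual x = f.toDual (x * star w)

/-- `τ (Ψ(|f|)) ∈ [0, ∞]` for increasing continuous `Ψ : [0, ∞) → [0, ∞)` with `Ψ(0) = 0`: the
supremum of the numbers `τ (Ψ(a))`, where `a` runs through the `a ∈ M` with `0 ≤ a ≤ |f|`. -/
def traceOfModulus (Ψ : ℝ → ℝ) (f : L1 τ) : ℝ≥0∞ :=
  ⨆ (ρ : L1 τ) (_ : IsModulus τ f ρ) (a : M) (_ : ∃ b : M, a = star b * b)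
    (_ : IsPos (ρ.toDual - embed τ a)), ENNReal.ofReal (τ (cfc Ψ a)).re

/-- The Luxemburg norm `‖f‖_Φ = inf {c > 0 : τ (Φ(|f| / c)) ≤ 1} ∈ [0, ∞]`.  The Orlicz space
`L_Φ(M, τ)`, which is contained in `L₁(M, τ)`, consists of the `f` with `‖f‖_Φ < ∞`. -/
def orliczNorm (Φ : ℝ → ℝ) (f : L1 τ) : ℝ≥0∞ :=
  ⨅ (c : ℝ) (_ : 0 < c) (_ : traceOfModulus τ (fun t => Φ (t / c)) f ≤ 1), ENNReal.ofReal c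

/-! ## Maximal norms -/

/-- The norm in `L₁(M; ℓ_∞(ι))`: the infimum of `‖α‖₂ (sup ‖hᵢ‖) ‖β‖₂` over all factorizations
`fᵢ = α hᵢ β` with `α, β ∈ L₂(M, τ)` and `(hᵢ)` bounded in `M`; it is infinite if there is no such
factorization.  The functional `α h β` is
`x ↦ τ (α h β x) = ⟪α*, h (β x)⟫`, and `a` below stands for `α*`, with `‖α*‖₂ = ‖α‖₂`. -/
def maxNorm {ι : Type*} (f : ι → StrongDual ℂ M) : ℝ≥0∞ :=
  ⨅ (a : L2 τ) (b : L2 τ) (h : ι → M) (_ : BddAbove (Set.range fun i => ‖h i‖))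
    (_ : ∀ i x, f i x = ⟪a, leftMul τ (h i) (rightMul τ x b)⟫_ℂ),
    ‖a‖ₑ * (⨆ i, ‖h i‖ₑ) * ‖b‖ₑ

/-- The norm of `(B_m)_m : L_Φ(M) → L₁(M; ℓ_∞)`. -/
def maxOpNorm (Φ : ℝ → ℝ) (B : ℕ → L1 τ →ₗ[ℂ] L1 τ) : ℝ≥0∞ :=
  sInf {C : ℝ≥0∞ | ∀ f : L1 τ, orliczNorm τ Φ f < ∞ →
    maxNorm τ (fun m => (B m f).toDual) ≤ C * orliczNorm τ Φ f}

/-! ## Bilateral almost uniform convergence and the noncommutative limsup -/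

/-- `f_n → g` bilaterally almost uniformly. -/
def TendstoBAU (f : ℕ → L1 τ) (g : L1 τ) : Prop :=
  ∀ ε : ℝ, 0 < ε → ∃ e : M, IsStarProjection e ∧ (τ e).re < ε ∧
    Filter.Tendsto (fun n => normInfty τ (compress (1 - e) ((f n).toDual - g.toDual)))
      Filter.atTop (nhds 0)

/-- `‖limsup⁺_{n,m → ∞} f_{n,m}‖₁ =
sup_{ε > 0} inf_{τ(e) < ε} inf_{N,K} ‖((1 - e) f_{n,m} (1 - e))_{n > N, m > K}‖_{L₁(M; ℓ_∞)}`. -/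
def limsupNorm (f : ℕ → ℕ → L1 τ) : ℝ≥0∞ :=
  ⨆ (ε : ℝ) (_ : 0 < ε), ⨅ (e : M) (_ : IsStarProjection e) (_ : (τ e).re < ε)
    (N : ℕ) (K : ℕ), maxNorm τ (fun i : Set.Ioi N × Set.Ioi K =>
      compress (1 - e) (f i.1 i.2).toDual)

end General

end NCIntegration

end

/-
The point is to replace order relations between operators by domination of sesquilinear forms,
`|u (x* y)|² ≤ g (x* x) g (y* y)`, which also makes sense for functionals `u` that are not
self-adjoint.

If `(v_m)` is a self-adjoint family whose norm in `L₁(M; ℓ_∞)` is less than `C`, a factorization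
`v_m = a h_m b` with `‖a‖₂² ≤ C`, `‖b‖₂² ≤ C` and the inequality between the arithmetic and
geometric means give a single `g ∈ L₁(M)` with `‖g‖₁ ≤ C` and `-g ≤ v_m ≤ g`.  Positivity of `A_n`
turns this into domination of `A_n v_m` by `A_n g` for all `m`, and domination is additive, so that
`A_n (v_m + i w_m)` is dominated by `A_n (g + k)` with no loss in the constant.  Now the double
sequence is under the control of the single sequence `A_n g`, which converges b.a.u. to `F g`: on a
corner `e^⊥ M e^⊥` it is at most `F g + η` for large `n`, hence at most a vector functional
`⟪ξ, · ξ⟫` on the Hilbert space `L₂(M)` with `‖ξ‖² ≤ ‖F g‖₁ + δ`.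

A functional `u` dominated by `⟪ξ, · ξ⟫` is of the form `⟪ξ, h · ξ⟫` with `‖h‖ ≤ 1` and `h` in `M`,
which is a factorization as required in `L₁(M; ℓ_∞)`.  The form `u` defines a contraction `h` that
commutes with the right multiplications by elements of `M`; that `h` belongs to `M` is the duality
`L₁(M)* = M`, which is derived from the normality of the trace and the weak compactness of balls.
-/

noncomputable section

namespace NCIntegration

universe u

section HilbertSpace

variable {M : Type u} [CStarAlgebra M] (τ : TracialState M)

/-- The canonical map from `M` to `L₂(M, τ)`. -/
def toL2 : M →ₗ[ℂ] L2 τ :=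
  (UniformSpace.Completion.toComplL : PreL2 τ →L[ℂ] L2 τ).toLinearMap ∘ₗ (toPreL2 τ).toLinearMap

lemma toL2_apply (x : M) : toL2 τ x = ((toPreL2 τ x : PreL2 τ) : L2 τ) := rfl

lemma denseRange_toL2 : DenseRange (toL2 τ) :=
  UniformSpace.Completion.denseRange_coe.comp (toPreL2 τ).surjective.denseRange
    (UniformSpace.Completion.continuous_coe _)

variable {τ} in
lemma L2.induction_on {p : L2 τ → Prop} (ξ : L2 τ) (isClosed : IsClosed {ξ | p ξ})
    (toL2 : ∀ x : M, p (toL2 τ x)) : p ξ :=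
  (denseRange_toL2 τ).induction_on ξ isClosed toL2

lemma inner_toL2 (x y : M) : ⟪toL2 τ x, toL2 τ y⟫_ℂ = τ.toFunctional (star x * y) := by
  rw [toL2_apply, toL2_apply, UniformSpace.Completion.inner_coe]
  rfl

lemma norm_sq_toL2 (x : M) : ‖toL2 τ x‖ ^ 2 = (τ.toFunctional (star x * x)).re := by
  rw [← inner_toL2, ← inner_self_eq_norm_sq (𝕜 := ℂ)]
  rfl

lemma norm_toL2_star (x : M) : ‖toL2 τ (star x)‖ = ‖toL2 τ x‖ := by
  rw [← sq_eq_sq₀ (norm_nonneg _) (norm_nonneg _), norm_sq_toL2, norm_sq_toL2, star_star,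
    τ.comm']

lemma norm_toL2_one : ‖toL2 τ (1 : M)‖ = 1 := by
  rw [← sq_eq_sq₀ (norm_nonneg _) zero_le_one, norm_sq_toL2, star_one, one_mul, τ.one',
    one_pow, Complex.one_re]

lemma norm_toL2_mul_le (x y : M) : ‖toL2 τ (x * y)‖ ≤ ‖x‖ * ‖toL2 τ y‖ := by
  rw [← sq_le_sq₀ (norm_nonneg _) (by positivity), mul_pow, norm_sq_toL2, norm_sq_toL2]
  exact τ.conj_bound x y

lemma norm_toL2_le (x : M) : ‖toL2 τ x‖ ≤ ‖x‖ := by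
  simpa [norm_toL2_one] using norm_toL2_mul_le τ x 1

lemma TracialState.norm_apply_le (x : M) : ‖τ.toFunctional x‖ ≤ ‖x‖ := by
  have h := norm_inner_le_norm (𝕜 := ℂ) (toL2 τ 1) (toL2 τ x)
  rw [inner_toL2, star_one, one_mul, norm_toL2_one, one_mul] at h
  exact h.trans (norm_toL2_le τ x)

lemma leftMul_toL2 (x y : M) : leftMul τ x (toL2 τ y) = toL2 τ (x * y) := by
  rw [leftMul, toL2_apply, ContinuousLinearMap.completion_apply_coe]
  rfl

lemma rightMul_toL2 (x y : M) : rightMul τ x (toL2 τ y) = toL2 τ (y * x) := by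
  rw [rightMul, toL2_apply, ContinuousLinearMap.completion_apply_coe]
  rfl

lemma norm_leftMul_apply_le (x : M) (ξ : L2 τ) : ‖leftMul τ x ξ‖ ≤ ‖x‖ * ‖ξ‖ := by
  induction ξ using L2.induction_on with
  | isClosed => exact isClosed_le (by fun_prop) (by fun_prop)
  | toL2 y =>
    rw [leftMul_toL2]
    exact norm_toL2_mul_le τ x y

lemma norm_rightMul_apply_le (x : M) (ξ : L2 τ) : ‖rightMul τ x ξ‖ ≤ ‖x‖ * ‖ξ‖ := by
  induction ξ using L2.induction_on with
  | isClosed => exact isClosed_le (by fun_prop) (by fun_prop)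
  | toL2 y =>
    have h := norm_toL2_mul_le τ (star x) (star y)
    rwa [← star_mul, norm_toL2_star, norm_toL2_star, norm_star, ← rightMul_toL2] at h

lemma rightMul_one (ξ : L2 τ) : rightMul τ 1 ξ = ξ := by
  induction ξ using L2.induction_on with
  | isClosed => exact isClosed_eq (by fun_prop) (by fun_prop)
  | toL2 z => rw [rightMul_toL2, mul_one]

lemma rightMul_mul (x y : M) (ξ : L2 τ) :
    rightMul τ (x * y) ξ = rightMul τ y (rightMul τ x ξ) := by
  induction ξ using L2.induction_on with
  | isClosed => exact isClosed_eq (by fun_prop) (by fun_prop)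
  | toL2 z => simp only [rightMul_toL2, mul_assoc]

lemma rightMul_add (x y : M) : rightMul τ (x + y) = rightMul τ x + rightMul τ y := by
  ext ξ
  induction ξ using L2.induction_on with
  | isClosed =>
    exact isClosed_eq (ContinuousLinearMap.continuous _) (ContinuousLinearMap.continuous _)
  | toL2 z => simp only [_root_.add_apply, rightMul_toL2, mul_add, map_add]

lemma rightMul_smul (c : ℂ) (x : M) : rightMul τ (c • x) = c • rightMul τ x := by
  ext ξ
  induction ξ using L2.induction_on with
  | isClosed =>
    exact isClosed_eq (ContinuousLinearMap.continuous _) (ContinuousLinearMap.continuous _)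
  | toL2 z => simp only [_root_.smul_apply, rightMul_toL2, mul_smul_comm, map_smul]

lemma leftMul_rightMul (x y : M) (ξ : L2 τ) :
    leftMul τ x (rightMul τ y ξ) = rightMul τ y (leftMul τ x ξ) := by
  induction ξ using L2.induction_on with
  | isClosed => exact isClosed_eq (by fun_prop) (by fun_prop)
  | toL2 z => simp only [rightMul_toL2, leftMul_toL2, mul_assoc]

lemma inner_rightMul_left (x : M) (ξ η : L2 τ) :
    ⟪rightMul τ x ξ, η⟫_ℂ = ⟪ξ, rightMul τ (star x) η⟫_ℂ := by
  induction ξ using L2.induction_on with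
  | isClosed => exact isClosed_eq (by fun_prop) (by fun_prop)
  | toL2 y =>
    induction η using L2.induction_on with
    | isClosed => exact isClosed_eq (by fun_prop) (by fun_prop)
    | toL2 z =>
      rw [rightMul_toL2, rightMul_toL2, inner_toL2, inner_toL2, star_mul, mul_assoc, τ.comm',
        mul_assoc]

lemma inner_rightMul_right (x : M) (ξ η : L2 τ) :
    ⟪ξ, rightMul τ x η⟫_ℂ = ⟪rightMul τ (star x) ξ, η⟫_ℂ := by
  rw [inner_rightMul_left, star_star]

/-- Right multiplication, as a bounded linear map from `M` to the operators on `L₂(M, τ)`. -/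
def rightMulCLM : M →L[ℂ] L2 τ →L[ℂ] L2 τ :=
  LinearMap.mkContinuous
    { toFun := rightMul τ
      map_add' := rightMul_add τ
      map_smul' := rightMul_smul τ } 1 fun x => by
    rw [one_mul]
    exact ContinuousLinearMap.opNorm_le_bound _ (norm_nonneg x) (norm_rightMul_apply_le τ x)

end HilbertSpace

section Functionals

variable {M : Type u} [CStarAlgebra M]

section Dual

variable {τ : TracialState M}

lemma L1.exists_toDual_eq {u : StrongDual ℂ M}
    (hu : u ∈ (LinearMap.range (embed τ)).topologicalClosure) : ∃ f : L1 τ, f.toDual = u :=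
  ⟨⟨u, hu⟩, rfl⟩

lemma L1.toDual_mem (f : L1 τ) :
    f.toDual ∈ (LinearMap.range (embed τ)).topologicalClosure :=
  Subtype.property (p := (· ∈ (LinearMap.range (embed τ)).topologicalClosure)) f

lemma L1.norm_toDual (f : L1 τ) : ‖f.toDual‖ = ‖f‖ := (L1.functional τ).norm_map f

lemma L1.toDual_zero : (0 : L1 τ).toDual = 0 := map_zero (L1.functional τ)

lemma L1.toDual_add (f g : L1 τ) : (f + g).toDual = f.toDual + g.toDual :=
  map_add (L1.functional τ) f g

lemma L1.toDual_sub (f g : L1 τ) : (f - g).toDual = f.toDual - g.toDual :=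
  map_sub (L1.functional τ) f g

lemma L1.toDual_smul (c : ℂ) (f : L1 τ) : (c • f).toDual = c • f.toDual :=
  map_smul (L1.functional τ) c f

end Dual

lemma IsPos.re_nonneg {p : StrongDual ℂ M} (hp : IsPos p) (x : M) : 0 ≤ (p (star x * x)).re :=
  (Complex.le_def.mp (hp x)).1

lemma IsPos.map_nonneg [PartialOrder M] [StarOrderedRing M] {p : StrongDual ℂ M} (hp : IsPos p)
    {a : M} (ha : 0 ≤ a) : 0 ≤ p a := by
  obtain ⟨b, rfl⟩ := CStarAlgebra.nonneg_iff_eq_star_mul_self.mp ha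
  exact hp b

lemma IsPos.map_star {p : StrongDual ℂ M} (hp : IsPos p) (x : M) : p (star x) = star (p x) := by
  let _ := CStarAlgebra.spectralOrder M
  let _ := CStarAlgebra.spectralOrderedRing M
  exact StarHomClass.map_star (PositiveLinearMap.mk₀ (p : M →ₗ[ℂ] ℂ) fun _ => hp.map_nonneg) x

lemma IsPos.norm_apply_star_mul_le {p : StrongDual ℂ M} (hp : IsPos p) (x y : M) :
    ‖p (star x * y)‖ ≤ √(p (star x * x)).re * √(p (star y * y)).re := by
  let _ := CStarAlgebra.spectralOrder M
  let _ := CStarAlgebra.spectralOrderedRing M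
  let g : M →ₚ[ℂ] ℂ := PositiveLinearMap.mk₀ (p : M →ₗ[ℂ] ℂ) fun _ => hp.map_nonneg
  exact norm_inner_le_norm (𝕜 := ℂ) (g.toPreGNS x) (g.toPreGNS y)

lemma L1.IsSA.im_apply_star_mul_self {τ : TracialState M} {f : L1 τ} (hf : f.IsSA) (x : M) :
    (f.toDual (star x * x)).im = 0 := by
  have h := hf (star x * x)
  rw [star_mul, star_star] at h
  exact Complex.conj_eq_iff_im.mp h.symm

variable (τ : TracialState M)

lemma embed_apply (z x : M) : embed τ z x = τ.toFunctional (z * x) := rfl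

lemma norm_trace_mul_le (z x : M) : ‖τ.toFunctional (z * x)‖ ≤ ‖embed τ z‖ * ‖x‖ :=
  (embed τ z).le_opNorm x

lemma norm_embed_one_le : ‖embed τ (1 : M)‖ ≤ 1 :=
  ContinuousLinearMap.opNorm_le_bound _ zero_le_one fun x => by
    rw [embed_apply, one_mul, one_mul]
    exact τ.norm_apply_le x

/-- The element `ξ* ξ` of `L₁(M, τ)` for `ξ ∈ L₂(M, τ)`, as the functional `x ↦ ⟪ξ, ξ x⟫`. -/
def vectorFunctional (ξ : L2 τ) : StrongDual ℂ M :=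
  innerSL ℂ ξ ∘L (rightMulCLM τ).flip ξ

lemma vectorFunctional_apply (ξ : L2 τ) (x : M) :
    vectorFunctional τ ξ x = ⟪ξ, rightMul τ x ξ⟫_ℂ := rfl

lemma vectorFunctional_one (ξ : L2 τ) : vectorFunctional τ ξ 1 = ((‖ξ‖ ^ 2 : ℝ) : ℂ) := by
  rw [vectorFunctional_apply, rightMul_one, inner_self_eq_norm_sq_to_K]
  norm_cast

lemma vectorFunctional_star_mul_self (ξ : L2 τ) (x : M) :
    vectorFunctional τ ξ (star x * x) = ((‖rightMul τ (star x) ξ‖ ^ 2 : ℝ) : ℂ) := by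
  rw [vectorFunctional_apply, rightMul_mul, inner_rightMul_right, inner_self_eq_norm_sq_to_K]
  norm_cast

lemma re_vectorFunctional_star_mul_self (ξ : L2 τ) (x : M) :
    (vectorFunctional τ ξ (star x * x)).re = ‖rightMul τ (star x) ξ‖ ^ 2 := by
  rw [vectorFunctional_star_mul_self, Complex.ofReal_re]

lemma isPos_vectorFunctional (ξ : L2 τ) : IsPos (vectorFunctional τ ξ) := fun x => by
  rw [vectorFunctional_star_mul_self, Complex.zero_le_real]
  positivity

lemma vectorFunctional_toL2 (x : M) :
    vectorFunctional τ (toL2 τ x) = embed τ (star x * x) := by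
  ext y
  rw [vectorFunctional_apply, rightMul_toL2, inner_toL2, ← mul_assoc, embed_apply]

lemma continuous_vectorFunctional : Continuous (vectorFunctional τ) := by
  unfold vectorFunctional
  fun_prop

lemma norm_vectorFunctional_le (ξ : L2 τ) : ‖vectorFunctional τ ξ‖ ≤ ‖ξ‖ ^ 2 :=
  ContinuousLinearMap.opNorm_le_bound _ (by positivity) fun x => by
    rw [vectorFunctional_apply]
    calc ‖⟪ξ, rightMul τ x ξ⟫_ℂ‖ ≤ ‖ξ‖ * ‖rightMul τ x ξ‖ := norm_inner_le_norm _ _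
      _ ≤ ‖ξ‖ * (‖x‖ * ‖ξ‖) := by gcongr; exact norm_rightMul_apply_le τ x ξ
      _ = ‖ξ‖ ^ 2 * ‖x‖ := by ring

lemma exists_toDual_eq_vectorFunctional (ξ : L2 τ) :
    ∃ f : L1 τ, f.toDual = vectorFunctional τ ξ := by
  refine L1.exists_toDual_eq ?_
  induction ξ using L2.induction_on with
  | isClosed =>
    exact (Submodule.isClosed_topologicalClosure _).preimage (continuous_vectorFunctional τ)
  | toL2 x =>
    rw [vectorFunctional_toL2]
    exact Submodule.le_topologicalClosure _ (LinearMap.mem_range_self _ _)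

end Functionals

section Factorization

variable {M : Type u} [CStarAlgebra M]

lemma star_val_inv {R : Type*} [Monoid R] [StarMul R] {r : Rˣ} (hr : IsSelfAdjoint (r : R)) :
    star (↑r⁻¹ : R) = ↑r⁻¹ := by
  have hr' : star r = r := Units.ext hr
  rw [← Units.coe_star_inv, hr']

section Order

variable [PartialOrder M] [StarOrderedRing M]

lemma exists_unit_mul_self_eq {b : M} (hb : IsStrictlyPositive b) :
    ∃ r : Mˣ, IsStrictlyPositive (r : M) ∧ (r * r : M) = b := by
  have hr : IsStrictlyPositive (CFC.sqrt b) := hb.sqrt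
  exact ⟨hr.isUnit.unit, hr, CFC.sqrt_mul_sqrt_self b hb.nonneg⟩

lemma norm_inv_mul_le_one {r : Mˣ} (hr : IsSelfAdjoint (r : M)) {c : M}
    (h : c * star c ≤ r * r) : ‖(↑r⁻¹ : M) * c‖ ≤ 1 := by
  have hle : (↑r⁻¹ * c) * star (↑r⁻¹ * c) ≤ (1 : M) :=
    calc (↑r⁻¹ * c) * star (↑r⁻¹ * c) = ↑r⁻¹ * (c * star c) * star (↑r⁻¹ : M) := by
          rw [star_mul]; simp only [mul_assoc]
      _ ≤ ↑r⁻¹ * (r * r) * star (↑r⁻¹ : M) := star_right_conjugate_le_conjugate h _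
      _ = 1 := by simp [star_val_inv hr]
  rw [← CStarAlgebra.norm_le_one_iff_of_nonneg _ (mul_star_self_nonneg _),
    CStarRing.norm_self_mul_star, ← sq] at hle
  exact (sq_le_one_iff₀ (norm_nonneg _)).mp hle

end Order

variable (τ : TracialState M)

/- With `r = (z* z + ε²)^(1/2)`, the factorization is `z = (z r^(-1/2)) r^(1/2)`. -/
lemma exists_eq_mul_norm_sq_le (z : M) {ε : ℝ} (hε : 0 < ε) :
    ∃ x y : M, z = x * y ∧ ‖toL2 τ x‖ ^ 2 ≤ ‖embed τ z‖ + ε ∧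
      ‖toL2 τ y‖ ^ 2 ≤ ‖embed τ z‖ + ε := by
  let _ := CStarAlgebra.spectralOrder M
  let _ := CStarAlgebra.spectralOrderedRing M
  let e : M := ε • 1
  have he : IsStrictlyPositive e := isStrictlyPositive_one.smul hε
  have he_star : star e = e := he.isSelfAdjoint
  have he_sq : IsStrictlyPositive (e * e) := by
    simpa using IsStrictlyPositive.conjugate_of_isUnit_of_isSelfAdjoint 1 e he.isUnit
  obtain ⟨r, hr, hr_sq⟩ :=
    exists_unit_mul_self_eq (he_sq.nonneg_add (star_mul_self_nonneg z))
  obtain ⟨s, hs, hs_sq⟩ := exists_unit_mul_self_eq hr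
  have hz : ‖(↑r⁻¹ : M) * star z‖ ≤ 1 := norm_inv_mul_le_one hr.isSelfAdjoint <| by
    rw [hr_sq, star_star, le_add_iff_nonneg_right]
    exact he_sq.nonneg
  have he_inv : ‖(↑r⁻¹ : M) * e‖ ≤ 1 := norm_inv_mul_le_one hr.isSelfAdjoint <| by
    rw [hr_sq, he_star, le_add_iff_nonneg_left]
    exact star_mul_self_nonneg z
  have htrace : (τ.toFunctional (z * (↑r⁻¹ * star z))).re ≤ ‖embed τ z‖ :=
    (Complex.re_le_norm _).trans <|
      (norm_trace_mul_le τ z _).trans (mul_le_of_le_one_right (norm_nonneg _) hz)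
  have hr_inv : (↑r⁻¹ : M) = ↑s⁻¹ * ↑s⁻¹ := by
    rw [← Units.val_mul, ← mul_inv_rev]
    exact congrArg (fun u : Mˣ => (↑u⁻¹ : M)) (Units.ext hs_sq.symm)
  refine ⟨z * ↑s⁻¹, s, by simp, ?_, ?_⟩
  · rw [norm_sq_toL2, τ.comm', star_mul, star_val_inv hs.isSelfAdjoint, mul_assoc,
      ← mul_assoc _ _ (star z), ← hr_inv]
    linarith
  · have hr_eq : (r : M) = ↑r⁻¹ * star z * z + ε • (↑r⁻¹ * e) :=
      calc (r : M) = ↑r⁻¹ * (r * r) := (r.inv_mul_cancel_left _).symm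
        _ = ↑r⁻¹ * star z * z + ε • (↑r⁻¹ * e) := by
          rw [hr_sq, mul_add, ← mul_assoc, ← mul_assoc, mul_smul_comm, mul_one]
    have he_trace : (τ.toFunctional (↑r⁻¹ * e)).re ≤ 1 :=
      (Complex.re_le_norm _).trans ((τ.norm_apply_le _).trans he_inv)
    rw [norm_sq_toL2, hs.isSelfAdjoint.star_eq, hs_sq, hr_eq, map_add, τ.comm' _ z,
      ← Complex.coe_smul, map_smul, Complex.coe_smul, Complex.add_re, Complex.real_smul,
      Complex.re_ofReal_mul]
    gcongr
    exact mul_le_of_le_one_right hε.le he_trace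

end Factorization

section VectorMajorant

open Filter Topology

variable {M : Type u} [CStarAlgebra M] (τ : TracialState M)

lemma inner_toL2_mul_star (x y c : M) :
    ⟪toL2 τ (x * star c), toL2 τ (y * star c)⟫_ℂ = embed τ (star x * y) (star c * c) := by
  rw [inner_toL2, embed_apply, star_mul, star_star, mul_assoc, τ.comm']
  simp only [mul_assoc]

lemma norm_sq_toL2_mul_star (x c : M) :
    ‖toL2 τ (x * star c)‖ ^ 2 = (embed τ (star x * x) (star c * c)).re := by
  rw [← inner_toL2_mul_star, ← inner_self_eq_norm_sq (𝕜 := ℂ)]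
  rfl

section Order

variable [PartialOrder M] [StarOrderedRing M]

lemma isPos_embed {a : M} (ha : 0 ≤ a) : IsPos (embed τ a) := by
  obtain ⟨b, rfl⟩ := CStarAlgebra.nonneg_iff_eq_star_mul_self.mp ha
  rw [← vectorFunctional_toL2]
  exact isPos_vectorFunctional τ _

lemma re_trace_nonneg {a : M} (ha : 0 ≤ a) : 0 ≤ (τ.toFunctional a).re := by
  obtain ⟨b, rfl⟩ := CStarAlgebra.nonneg_iff_eq_star_mul_self.mp ha
  exact norm_sq_toL2 τ b ▸ sq_nonneg _

lemma vectorFunctional_toL2_sqrt {c : M} (hc : 0 ≤ c) :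
    vectorFunctional τ (toL2 τ (CFC.sqrt c)) = embed τ c := by
  rw [vectorFunctional_toL2, (CFC.sqrt_nonneg c).isSelfAdjoint.star_eq,
    CFC.sqrt_mul_sqrt_self c hc]

/- For `z = x y` the majorant is `(x x* + y* y) / 2`, by the inequality of the means. -/
lemma exists_nonneg_embed_majorant (z : M) {ε : ℝ} (hε : 0 < ε) :
    ∃ p : M, 0 ≤ p ∧ (τ.toFunctional p).re ≤ ‖embed τ z‖ + ε ∧
      ∀ c, (embed τ z (star c * c)).re ≤ (embed τ p (star c * c)).re := by
  obtain ⟨x, y, rfl, hx, hy⟩ := exists_eq_mul_norm_sq_le τ z hε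
  have half_re (a b : ℂ) : (((2⁻¹ : ℝ) : ℂ) * (a + b)).re = (a.re + b.re) / 2 := by
    rw [Complex.re_ofReal_mul, Complex.add_re]
    ring
  refine ⟨(2⁻¹ : ℝ) • (x * star x + star y * y), smul_nonneg (by norm_num)
    (add_nonneg (mul_star_self_nonneg x) (star_mul_self_nonneg y)), ?_, fun c => ?_⟩
  · rw [← Complex.coe_smul, map_smul, map_add, smul_eq_mul, half_re, τ.comm', ← norm_sq_toL2,
      ← norm_sq_toL2]
    linarith
  · have hinner := inner_toL2_mul_star τ (star x) y c
    have hx_norm := norm_sq_toL2_mul_star τ (star x) c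
    rw [star_star] at hinner hx_norm
    rw [← Complex.coe_smul, map_smul, map_add, _root_.smul_apply, _root_.add_apply, smul_eq_mul,
      half_re, ← hx_norm, ← norm_sq_toL2_mul_star, ← hinner]
    set ξ := toL2 τ (star x * star c)
    set η := toL2 τ (y * star c)
    have hcs : (⟪ξ, η⟫_ℂ).re ≤ ‖ξ‖ * ‖η‖ := re_inner_le_norm (𝕜 := ℂ) ξ η
    linarith [two_mul_le_add_sq ‖ξ‖ ‖η‖]

lemma norm_toL2_sqrt_sub_sqrt_sq_le {c d : M} (hc : 0 ≤ c) (hcd : c ≤ d) :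
    ‖toL2 τ (CFC.sqrt d) - toL2 τ (CFC.sqrt c)‖ ^ 2 ≤
      (τ.toFunctional d).re - (τ.toFunctional c).re := by
  set s := CFC.sqrt c
  set t := CFC.sqrt d
  have hs : 0 ≤ s := CFC.sqrt_nonneg c
  have hts : star (t - s) = t - s :=
    ((CFC.sqrt_nonneg d).isSelfAdjoint.sub hs.isSelfAdjoint).star_eq
  have hs2 : s * s = c := CFC.sqrt_mul_sqrt_self c hc
  have ht2 : t * t = d := CFC.sqrt_mul_sqrt_self d (hc.trans hcd)
  have hcross : 0 ≤ (τ.toFunctional (s * (t - s))).re := by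
    obtain ⟨r, hr⟩ := CStarAlgebra.nonneg_iff_eq_star_mul_self.mp
      (sub_nonneg.mpr (CFC.sqrt_le_sqrt c d hcd))
    rw [hr]
    exact (isPos_embed τ hs).re_nonneg r
  rw [mul_sub, hs2, map_sub, Complex.sub_re] at hcross
  rw [← map_sub, norm_sq_toL2, hts, sub_mul, mul_sub, mul_sub, hs2, ht2,
    map_sub, map_sub, map_sub, τ.comm' t s]
  simp only [Complex.sub_re]
  linarith

lemma exists_tendsto_vectorFunctional_of_monotone {c : ℕ → M} (hc : Monotone c)
    (hc0 : ∀ n, 0 ≤ c n) {C : ℝ} (hC : ∀ n, (τ.toFunctional (c n)).re ≤ C) :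
    ∃ ξ : L2 τ, Tendsto (fun n => embed τ (c n)) atTop (𝓝 (vectorFunctional τ ξ)) := by
  set t : ℕ → ℝ := fun n => (τ.toFunctional (c n)).re
  have hsub {n m : ℕ} (hnm : n ≤ m) :
      ‖toL2 τ (CFC.sqrt (c m)) - toL2 τ (CFC.sqrt (c n))‖ ^ 2 ≤ t m - t n :=
    norm_toL2_sqrt_sub_sqrt_sq_le τ (hc0 n) (hc hnm)
  have ht : Monotone t := fun n m hnm => sub_nonneg.mp ((sq_nonneg _).trans (hsub hnm))
  have hbdd : BddAbove (Set.range t) := ⟨C, Set.forall_mem_range.mpr hC⟩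
  have hlim : Tendsto (fun n => √((⨆ n, t n) - t n)) atTop (𝓝 0) := by
    simpa using ((tendsto_atTop_ciSup ht hbdd).const_sub (⨆ n, t n)).sqrt
  have hcauchy : CauchySeq fun n => toL2 τ (CFC.sqrt (c n)) := by
    refine cauchySeq_of_le_tendsto_0' _ (fun n m hnm => ?_) hlim
    rw [dist_eq_norm, norm_sub_rev]
    exact Real.le_sqrt_of_sq_le ((hsub hnm).trans (sub_le_sub_right (le_ciSup hbdd m) _))
  obtain ⟨ξ, hξ⟩ := cauchySeq_tendsto_of_complete hcauchy
  refine ⟨ξ, (((continuous_vectorFunctional τ).tendsto ξ).comp hξ).congr fun n => ?_⟩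
  exact vectorFunctional_toL2_sqrt τ (hc0 n)

/- Approximating `f` by a rapidly convergent series `∑ τ (zₙ ·)`, add up majorants of the `zₙ`. -/
lemma exists_monotone_embed_majorant (f : L1 τ) {δ : ℝ} (hδ : 0 < δ) :
    ∃ (c : ℕ → M) (v : ℕ → StrongDual ℂ M), Monotone c ∧ (∀ n, 0 ≤ c n) ∧
      (∀ n, (τ.toFunctional (c n)).re ≤ ‖f‖ + δ) ∧ Tendsto v atTop (𝓝 f.toDual) ∧
      ∀ n x, (v n (star x * x)).re ≤ (embed τ (c n) (star x * x)).re := by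
  set b : ℕ → ℝ := fun n => δ / 2 / 2 / 2 ^ n
  have hb (n : ℕ) : 0 < b n := by positivity
  obtain ⟨v, hv, hv_mem, hv_zero, hv_succ⟩ := controlled_sum_of_mem_closure
    (s := (LinearMap.range (embed τ)).toAddSubgroup) f.toDual_mem hb
  choose z hz using hv_mem
  choose p hp0 hp_trace hp using fun n => exists_nonneg_embed_majorant τ (z n) (hb n)
  set B : ℕ → ℝ := fun n => (if n = 0 then ‖f‖ else 0) + δ / 2 / 2 ^ n
  have hB : HasSum B (‖f‖ + δ) := (hasSum_ite_eq 0 ‖f‖).add (hasSum_geometric_two' δ)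
  have hpB (n : ℕ) : (τ.toFunctional (p n)).re ≤ B n := by
    have hb_add : b n + b n = δ / 2 / 2 ^ n := by simp only [b]; ring
    have hpn : (τ.toFunctional (p n)).re ≤ ‖v n‖ + b n := hz n ▸ hp_trace n
    rcases Nat.eq_zero_or_pos n with rfl | hn
    · have h := norm_le_norm_add_norm_sub' (v 0) f.toDual
      rw [L1.norm_toDual] at h
      simp only [B, if_pos]
      rw [neg_add_eq_sub, norm_sub_rev] at hv_zero
      linarith
    · simp only [B, if_neg hn.ne', zero_add]
      linarith [hv_succ n hn]
  refine ⟨fun n => ∑ i ∈ Finset.range (n + 1), p i, _, monotone_nat_of_le_succ fun n => ?_,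
    fun n => Finset.sum_nonneg fun i _ => hp0 i, fun n => ?_, hv, fun n x => ?_⟩
  · rw [Finset.sum_range_succ _ (n + 1)]
    exact le_add_of_nonneg_right (hp0 _)
  · rw [map_sum, Complex.re_sum]
    exact (Finset.sum_le_sum fun i _ => hpB i).trans
      (sum_le_hasSum _ (fun i _ => (re_trace_nonneg τ (hp0 i)).trans (hpB i)) hB)
  · simp only [map_sum, _root_.sum_apply, Complex.re_sum]
    exact Finset.sum_le_sum fun i _ => hz i ▸ hp i x

end Order

lemma exists_vector_majorant (f : L1 τ) {δ : ℝ} (hδ : 0 < δ) :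
    ∃ ξ : L2 τ, ‖ξ‖ ^ 2 ≤ ‖f‖ + δ ∧
      ∀ x, (f.toDual (star x * x)).re ≤ ‖rightMul τ (star x) ξ‖ ^ 2 := by
  let _ := CStarAlgebra.spectralOrder M
  let _ := CStarAlgebra.spectralOrderedRing M
  obtain ⟨c, v, hc, hc0, hc_trace, hv, hvc⟩ := exists_monotone_embed_majorant τ f hδ
  obtain ⟨ξ, hξ⟩ := exists_tendsto_vectorFunctional_of_monotone τ hc hc0 hc_trace
  have tendsto_re_apply {w : ℕ → StrongDual ℂ M} {g : StrongDual ℂ M}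
      (hw : Tendsto w atTop (𝓝 g)) (x : M) :
      Tendsto (fun n => (w n x).re) atTop (𝓝 (g x).re) :=
    (Complex.continuous_re.comp (continuous_eval_const x)).tendsto g |>.comp hw
  refine ⟨ξ, ?_, fun x => ?_⟩
  · have hξ_one := tendsto_re_apply hξ 1
    simp only [vectorFunctional_one, Complex.ofReal_re, embed_apply, mul_one] at hξ_one
    exact le_of_tendsto' hξ_one hc_trace
  · rw [← re_vectorFunctional_star_mul_self]
    exact le_of_tendsto_of_tendsto' (tendsto_re_apply hv _) (tendsto_re_apply hξ _)
      fun n => hvc n x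

end VectorMajorant

section PositivityPreserving

variable {M : Type u} [CStarAlgebra M] {τ : TracialState M}

lemma L1.IsSA.exists_eq_sub {f : L1 τ} (hf : f.IsSA) :
    ∃ p q : L1 τ, IsPos p.toDual ∧ IsPos q.toDual ∧ f = p - q := by
  obtain ⟨ξ, -, hξ⟩ := exists_vector_majorant τ f one_pos
  obtain ⟨p, hp⟩ := exists_toDual_eq_vectorFunctional τ ξ
  refine ⟨p, p - f, hp ▸ isPos_vectorFunctional τ ξ, fun x => ?_, (sub_sub_cancel p f).symm⟩
  rw [L1.toDual_sub, _root_.sub_apply, hp, vectorFunctional_star_mul_self, sub_nonneg,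
    Complex.le_def]
  exact ⟨hξ x, hf.im_apply_star_mul_self x⟩

lemma IsPositivityPreserving.isSA {T : L1 τ →ₗ[ℂ] L1 τ} (hT : IsPositivityPreserving τ T)
    {f : L1 τ} (hf : f.IsSA) : (T f).IsSA := by
  obtain ⟨p, q, hp, hq, rfl⟩ := hf.exists_eq_sub
  intro x
  rw [map_sub, L1.toDual_sub, _root_.sub_apply, _root_.sub_apply, (hT p hp).map_star,
    (hT q hq).map_star, star_sub]

end PositivityPreserving

section SesquilinearForms

variable {𝕜 V E : Type*} [RCLike 𝕜] [AddCommGroup V] [Module 𝕜 V] [NormedAddCommGroup E]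
  [InnerProductSpace 𝕜 E] [CompleteSpace E] (e : V →ₗ[𝕜] E) (b : V →ₗ⋆[𝕜] V →ₗ[𝕜] 𝕜) {C : ℝ}

lemma exists_inner_eq_of_denseRange (he : DenseRange e) (hC : 0 ≤ C)
    (hb : ∀ x z, ‖b x z‖ ≤ C * ‖e x‖ * ‖e z‖) :
    ∃ T : E →L[𝕜] E, ‖T‖ ≤ C ∧ ∀ x z, ⟪e x, T (e z)⟫_𝕜 = b x z := by
  let riesz (x : V) : E := (InnerProductSpace.toDual 𝕜 E).symm ((b x).extendOfNorm e)
  have inner_riesz (x z : V) : ⟪riesz x, e z⟫_𝕜 = b x z := by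
    rw [InnerProductSpace.toDual_symm_apply, LinearMap.extendOfNorm_eq he ⟨_, hb x⟩]
  have norm_riesz_le (x : V) : ‖riesz x‖ ≤ C * ‖e x‖ := by
    rw [LinearIsometryEquiv.norm_map]
    exact LinearMap.opNorm_extendOfNorm_le he (by positivity) (hb x)
  let g : V →ₗ[𝕜] E :=
    { toFun := riesz
      map_add' := fun x y => he.eq_of_inner_left 𝕜 fun z => by
        rw [inner_add_left, inner_riesz, inner_riesz, inner_riesz, map_add, LinearMap.add_apply]
      map_smul' := fun c x => he.eq_of_inner_left 𝕜 fun z => by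
        rw [RingHom.id_apply, inner_smul_left, inner_riesz, inner_riesz, map_smulₛₗ,
          LinearMap.smul_apply, smul_eq_mul] }
  refine ⟨(g.extendOfNorm e).adjoint, ?_, fun x z => ?_⟩
  · rw [LinearIsometryEquiv.norm_map]
    exact LinearMap.opNorm_extendOfNorm_le he hC norm_riesz_le
  · rw [ContinuousLinearMap.adjoint_inner_right,
      LinearMap.extendOfNorm_eq he ⟨C, norm_riesz_le⟩]
    exact inner_riesz x z

/-- Without a density assumption the operator is made unique by requiring that it be carried by
the closure of the range of `e`. -/
lemma exists_inner_eq (hC : 0 ≤ C) (hb : ∀ x z, ‖b x z‖ ≤ C * ‖e x‖ * ‖e z‖) :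
    ∃ T : E →L[𝕜] E, ‖T‖ ≤ C ∧ (∀ x z, ⟪e x, T (e z)⟫_𝕜 = b x z) ∧
      (∀ ξ, T ξ ∈ (LinearMap.range e).topologicalClosure) ∧
      ∀ ξ ∈ (LinearMap.range e)ᗮ, T ξ = 0 := by
  set K := (LinearMap.range e).topologicalClosure with hK
  have : CompleteSpace K := (Submodule.isClosed_topologicalClosure _).completeSpace_coe
  have hmem (x : V) : e x ∈ K := Submodule.le_topologicalClosure _ (LinearMap.mem_range_self e x)
  have hdense : DenseRange (e.codRestrict K hmem) := fun k => by
    rw [closure_subtype, ← Set.range_comp]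
    exact k.2
  obtain ⟨T, hT, hTb⟩ := exists_inner_eq_of_denseRange (e.codRestrict K hmem) b hdense hC hb
  refine ⟨K.subtypeL ∘L T ∘L K.orthogonalProjectionOnto, ?_, fun x z => ?_, fun ξ => (T _).2,
    fun ξ hξ => ?_⟩
  · refine ContinuousLinearMap.opNorm_le_bound _ hC fun ξ => ?_
    calc ‖T (K.orthogonalProjectionOnto ξ)‖ ≤ C * ‖K.orthogonalProjectionOnto ξ‖ :=
          T.le_of_opNorm_le hT _
      _ ≤ C * ‖ξ‖ := by
        gcongr
        exact Submodule.norm_orthogonalProjectionOnto_apply_le _ _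
  · have hproj : K.orthogonalProjectionOnto (e z) = e.codRestrict K hmem z :=
      Submodule.orthogonalProjectionOnto_mem_subspace_eq_self (e.codRestrict K hmem z)
    simp only [ContinuousLinearMap.comp_apply, hproj]
    exact hTb x z
  · rw [← Submodule.orthogonal_closure, ← hK] at hξ
    simp only [ContinuousLinearMap.comp_apply,
      Submodule.orthogonalProjectionOnto_apply_of_mem_orthogonal hξ, map_zero]

variable {e} in
lemma eq_of_inner_eq_on_range {S T : E →L[𝕜] E}
    (hST : ∀ x z, ⟪e x, S (e z)⟫_𝕜 = ⟪e x, T (e z)⟫_𝕜)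
    (hS : ∀ ξ, S ξ ∈ (LinearMap.range e).topologicalClosure)
    (hT : ∀ ξ, T ξ ∈ (LinearMap.range e).topologicalClosure)
    (hS₀ : ∀ ξ ∈ (LinearMap.range e)ᗮ, S ξ = 0) (hT₀ : ∀ ξ ∈ (LinearMap.range e)ᗮ, T ξ = 0) :
    S = T := by
  set K := (LinearMap.range e).topologicalClosure with hK
  have : CompleteSpace K := (Submodule.isClosed_topologicalClosure _).completeSpace_coe
  have heqOn_range : Set.EqOn S T (Set.range e) := by
    rintro _ ⟨z, rfl⟩
    refine sub_eq_zero.mp (Submodule.disjoint_def.mp K.orthogonal_disjoint _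
      (K.sub_mem (hS _) (hT _)) ?_)
    rw [hK, Submodule.orthogonal_closure, Submodule.mem_orthogonal]
    rintro _ ⟨x, rfl⟩
    rw [inner_sub_right, hST, sub_self]
  have heqOn : Set.EqOn S T K := heqOn_range.closure S.continuous T.continuous
  ext ξ
  rw [← sub_add_cancel ξ (K.starProjection ξ), map_add, map_add,
    heqOn (Submodule.starProjection_apply_mem K ξ)]
  have hξ : ξ - K.starProjection ξ ∈ (LinearMap.range e)ᗮ := by
    rw [← Submodule.orthogonal_closure]
    exact Submodule.sub_starProjection_mem_orthogonal ξ
  rw [hS₀ _ hξ, hT₀ _ hξ]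

lemma exists_inner_eq_of_invariant (hC : 0 ≤ C) (hb : ∀ x z, ‖b x z‖ ≤ C * ‖e x‖ * ‖e z‖)
    {ι : Type*} (R : ι → E →L[𝕜] E) (r r' : ι → V → V) (hr : ∀ i x, e (r i x) = R i (e x))
    (hr' : ∀ i x, e (r' i x) = (R i).adjoint (e x)) (hbr : ∀ i x z, b (r' i x) z = b x (r i z)) :
    ∃ T : E →L[𝕜] E, ‖T‖ ≤ C ∧ (∀ i, T ∘L R i = R i ∘L T) ∧ ∀ x z, ⟪e x, T (e z)⟫_𝕜 = b x z := by
  obtain ⟨T, hTC, hTb, hT, hT₀⟩ := exists_inner_eq e b hC hb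
  refine ⟨T, hTC, fun i => eq_of_inner_eq_on_range (e := e) (fun x z => ?_) (fun ξ => hT _)
    (fun ξ => ?_) (fun ξ hξ => ?_) fun ξ hξ => ?_, hTb⟩
  · rw [ContinuousLinearMap.comp_apply, ContinuousLinearMap.comp_apply, ← hr, hTb, ← hbr, ← hTb,
      hr', ContinuousLinearMap.adjoint_inner_left]
  · have hmaps : Set.MapsTo (R i) (Set.range e) (Set.range e) := by
      rintro _ ⟨x, rfl⟩
      exact ⟨r i x, hr i x⟩
    exact hmaps.closure (R i).continuous (hT ξ)
  · refine hT₀ (R i ξ) ?_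
    rw [Submodule.mem_orthogonal] at hξ ⊢
    rintro _ ⟨x, rfl⟩
    rw [← ContinuousLinearMap.adjoint_inner_left, ← hr']
    exact hξ _ (LinearMap.mem_range_self e _)
  · rw [ContinuousLinearMap.comp_apply, hT₀ ξ hξ, map_zero]

end SesquilinearForms

section Commutant

variable {M : Type u} [CStarAlgebra M] (τ : TracialState M)

lemma adjoint_rightMul (x : M) : (rightMul τ x).adjoint = rightMul τ (star x) :=
  ((ContinuousLinearMap.eq_adjoint_iff _ _).mpr fun ξ η => by
    rw [inner_rightMul_left, star_star]).symm

lemma exists_commuting_contraction (u : StrongDual ℂ M) (ξ : L2 τ)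
    (hu : ∀ x z, ‖u (z * star x)‖ ≤ ‖rightMul τ x ξ‖ * ‖rightMul τ z ξ‖) :
    ∃ T : L2 τ →L[ℂ] L2 τ, ‖T‖ ≤ 1 ∧ (∀ y, T ∘L rightMul τ y = rightMul τ y ∘L T) ∧
      ∀ x, u x = ⟪ξ, T (rightMul τ x ξ)⟫_ℂ := by
  let b : M →ₗ⋆[ℂ] M →ₗ[ℂ] ℂ :=
    LinearMap.mk₂'ₛₗ (starRingEnd ℂ) (RingHom.id ℂ) (fun x z => u (z * star x))
      (fun x y z => by simp only [star_add, mul_add, map_add])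
      (fun c x z => by
        simp only [star_smul, mul_smul_comm, map_smul, smul_eq_mul, starRingEnd_apply])
      (fun x y z => by simp only [add_mul, map_add])
      (fun c x z => by simp only [smul_mul_assoc, map_smul, smul_eq_mul, RingHom.id_apply])
  obtain ⟨T, hT, hcomm, hTu⟩ := exists_inner_eq_of_invariant
    ((rightMulCLM τ).flip ξ).toLinearMap b zero_le_one (fun x z => by rw [one_mul]; exact hu x z)
    (rightMul τ) (fun y z => z * y) (fun y x => x * star y)
    (fun y z => rightMul_mul τ z y ξ)
    (fun y x => by rw [adjoint_rightMul]; exact rightMul_mul τ x (star y) ξ)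
    (fun y x z => congrArg u (by rw [star_mul, star_star, mul_assoc]))
  have h (x : M) : ⟪rightMul τ 1 ξ, T (rightMul τ x ξ)⟫_ℂ = u (x * star 1) := hTu 1 x
  simp only [rightMul_one, star_one, mul_one] at h
  exact ⟨T, hT, hcomm, fun x => (h x).symm⟩

end Commutant

section Compactness

open Filter Topology

lemma exists_tendsto_inner_of_ultrafilter {𝕜 E ι : Type*} [RCLike 𝕜] [NormedAddCommGroup E]
    [InnerProductSpace 𝕜 E] [CompleteSpace E] (U : Ultrafilter ι) (T : ι → E →L[𝕜] E) {C : ℝ}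
    (hT : ∀ i, ‖T i‖ ≤ C) :
    ∃ T₀ : E →L[𝕜] E, ‖T₀‖ ≤ C ∧ ∀ ξ η, Tendsto (fun i => ⟪ξ, T i η⟫_𝕜) U (𝓝 ⟪ξ, T₀ η⟫_𝕜) := by
  obtain ⟨i₀⟩ : Nonempty ι := (U : Filter ι).nonempty_of_neBot
  have hbound (ξ η : E) (i : ι) : ‖⟪ξ, T i η⟫_𝕜‖ ≤ C * ‖ξ‖ * ‖η‖ :=
    calc ‖⟪ξ, T i η⟫_𝕜‖ ≤ ‖ξ‖ * ‖T i η‖ := norm_inner_le_norm _ _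
      _ ≤ ‖ξ‖ * (C * ‖η‖) := by
        gcongr
        exact (T i).le_of_opNorm_le (hT i) η
      _ = C * ‖ξ‖ * ‖η‖ := by ring
  have hlim (ξ η : E) : ∃ c : 𝕜, Tendsto (fun i => ⟪ξ, T i η⟫_𝕜) U (𝓝 c) := by
    obtain ⟨c, -, hc⟩ := (isCompact_closedBall (0 : 𝕜) (C * ‖ξ‖ * ‖η‖)).ultrafilter_le_nhds
      (U.map fun i => ⟪ξ, T i η⟫_𝕜)
      (tendsto_principal.mpr (Eventually.of_forall fun i => by simpa using hbound ξ η i))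
    exact ⟨c, hc⟩
  choose b hb using hlim
  let form : E →ₗ⋆[𝕜] E →ₗ[𝕜] 𝕜 := LinearMap.mk₂'ₛₗ (starRingEnd 𝕜) (RingHom.id 𝕜) b
    (fun ξ ξ' η => tendsto_nhds_unique (hb _ _)
      (by simpa only [inner_add_left] using (hb ξ η).add (hb ξ' η)))
    (fun c ξ η => tendsto_nhds_unique (hb _ _)
      (by simpa only [inner_smul_left, smul_eq_mul] using (hb ξ η).const_mul _))
    (fun ξ η η' => tendsto_nhds_unique (hb _ _)
      (by simpa only [map_add, inner_add_right] using (hb ξ η).add (hb ξ η')))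
    (fun c ξ η => tendsto_nhds_unique (hb _ _)
      (by simpa only [map_smul, inner_smul_right, smul_eq_mul, RingHom.id_apply]
        using (hb ξ η).const_mul _))
  obtain ⟨T₀, hT₀, hform⟩ := exists_inner_eq_of_denseRange LinearMap.id form
    Function.surjective_id.denseRange ((norm_nonneg _).trans (hT i₀))
    fun ξ η => le_of_tendsto (hb ξ η).norm (Eventually.of_forall (hbound ξ η))
  exact ⟨T₀, hT₀, fun ξ η => (hform ξ η).symm ▸ hb ξ η⟩

variable {H : Type u} [NormedAddCommGroup H] [InnerProductSpace ℂ H] [CompleteSpace H]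
  {S : VonNeumannAlgebra H}

lemma mem_of_tendsto_inner {l : Filter S} [l.NeBot] {T : H →L[ℂ] H}
    (hT : ∀ ξ η, Tendsto (fun h : S => ⟪ξ, (h : H →L[ℂ] H) η⟫_ℂ) l (𝓝 ⟪ξ, T η⟫_ℂ)) : T ∈ S := by
  rw [← SetLike.mem_coe, ← S.centralizer_centralizer]
  intro y hy
  ext η
  refine ext_inner_left ℂ fun ξ => ?_
  have hleft := hT (ContinuousLinearMap.adjoint y ξ) η
  simp only [ContinuousLinearMap.adjoint_inner_left] at hleft
  refine tendsto_nhds_unique hleft ((hT ξ (y η)).congr fun h => ?_)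
  have hcomm : (h : H →L[ℂ] H) (y η) = y ((h : H →L[ℂ] H) η) :=
    congrArg (fun A : H →L[ℂ] H => A η) (hy h h.2)
  rw [hcomm]

lemma exists_tendsto_inner_of_eventually_norm_le (U : Ultrafilter S) {C : ℝ}
    (hU : ∀ᶠ h in (U : Filter S), ‖h‖ ≤ C) :
    ∃ h₀ : S, ‖h₀‖ ≤ C ∧ ∀ ξ η, Tendsto (fun h : S => ⟪ξ, (h : H →L[ℂ] H) η⟫_ℂ) U
      (𝓝 ⟪ξ, (h₀ : H →L[ℂ] H) η⟫_ℂ) := by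
  classical
  obtain ⟨h₁, hh₁⟩ := hU.exists
  obtain ⟨T, hTC, hT⟩ := exists_tendsto_inner_of_ultrafilter U
    (fun h : S => if ‖h‖ ≤ C then (h : H →L[ℂ] H) else 0) (C := C) fun h => by
      split_ifs with hh
      · exact hh
      · simpa only [norm_zero] using (norm_nonneg h₁).trans hh₁
  have hlim (ξ η : H) : Tendsto (fun h : S => ⟪ξ, (h : H →L[ℂ] H) η⟫_ℂ) U (𝓝 ⟪ξ, T η⟫_ℂ) :=
    (hT ξ η).congr' (hU.mono fun h hh => by simp only [if_pos hh])
  exact ⟨⟨T, mem_of_tendsto_inner hlim⟩, hTC, hlim⟩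

lemma TracialState.IsNormal.tendsto {τ : TracialState S} (hτ : τ.IsNormal) {l : Filter S} {C : ℝ}
    (hl : ∀ᶠ h in l, ‖h‖ ≤ C) {h₀ : S}
    (hlim : ∀ ξ η, Tendsto (fun h : S => ⟪ξ, (h : H →L[ℂ] H) η⟫_ℂ) l
      (𝓝 ⟪ξ, (h₀ : H →L[ℂ] H) η⟫_ℂ)) (x : S) :
    Tendsto (fun h : S => τ.toFunctional (h * x)) l (𝓝 (τ.toFunctional (h₀ * x))) := by
  obtain ⟨ξ, η, hξ, hη, hsum⟩ := hτ
  have hτ_eq (h : S) : ∑' i, ⟪ξ i, (h : H →L[ℂ] H) ((x : H →L[ℂ] H) (η i))⟫_ℂ =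
      τ.toFunctional (h * x) := (hsum (h * x)).tsum_eq
  have hnorm (h : S) (hh : ‖h‖ ≤ C) (i : ℕ) :
      ‖⟪ξ i, (h : H →L[ℂ] H) ((x : H →L[ℂ] H) (η i))⟫_ℂ‖ ≤
        C * ‖x‖ * (‖ξ i‖ ^ 2 + ‖η i‖ ^ 2) := by
    have hC : 0 ≤ C := (norm_nonneg h).trans hh
    calc ‖⟪ξ i, (h : H →L[ℂ] H) ((x : H →L[ℂ] H) (η i))⟫_ℂ‖
        ≤ ‖ξ i‖ * ‖(h : H →L[ℂ] H) ((x : H →L[ℂ] H) (η i))‖ := norm_inner_le_norm _ _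
      _ ≤ ‖ξ i‖ * (C * (‖x‖ * ‖η i‖)) := by
        gcongr
        refine ((h : H →L[ℂ] H).le_of_opNorm_le hh _).trans ?_
        gcongr
        exact (x : H →L[ℂ] H).le_opNorm _
      _ = C * ‖x‖ * (‖ξ i‖ * ‖η i‖) := by ring
      _ ≤ C * ‖x‖ * (‖ξ i‖ ^ 2 + ‖η i‖ ^ 2) := by
        gcongr
        nlinarith only [sq_nonneg (‖ξ i‖ - ‖η i‖), sq_nonneg ‖ξ i‖, sq_nonneg ‖η i‖]
  simpa only [hτ_eq] using tendsto_tsum_of_dominated_convergence ((hξ.add hη).mul_left (C * ‖x‖))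
    (fun i => hlim (ξ i) ((x : H →L[ℂ] H) (η i))) (hl.mono hnorm)

/-- The embedding of `S` into its dual, the dual being equipped with the weak-* topology. -/
def weakEmbed (τ : TracialState S) : S →ₗ[ℂ] WeakBilin (topDualPairing ℂ S) := embed τ

lemma injective_topDualPairing (𝕜 V : Type*) [RCLike 𝕜] [NormedAddCommGroup V] [NormedSpace 𝕜 V] :
    Function.Injective (topDualPairing 𝕜 V) := ContinuousLinearMap.coe_injective

lemma isCompact_weakEmbed_image_closedBall {τ : TracialState S} (hτ : τ.IsNormal) (C : ℝ) :
    IsCompact (weakEmbed τ '' Metric.closedBall 0 C) := by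
  rw [isCompact_iff_ultrafilter_le_nhds']
  intro V hV
  set U : Ultrafilter S := Ultrafilter.ofComapInfPrincipal hV
  have hU : ∀ᶠ h in (U : Filter S), ‖h‖ ≤ C := by
    filter_upwards [Ultrafilter.ofComapInfPrincipal_mem hV] with h hh
      using mem_closedBall_zero_iff.mp hh
  obtain ⟨h₀, hh₀, hlim⟩ := exists_tendsto_inner_of_eventually_norm_le U hU
  rw [← Ultrafilter.ofComapInfPrincipal_eq_of_map hV]
  exact ⟨weakEmbed τ h₀, ⟨h₀, mem_closedBall_zero_iff.mpr hh₀, rfl⟩,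
    (WeakBilin.tendsto_iff_forall_eval_tendsto _ (injective_topDualPairing ℂ S)).mpr
      (hτ.tendsto hU hlim)⟩

lemma isClosed_weakEmbed_image_closedBall {τ : TracialState S} (hτ : τ.IsNormal) (C : ℝ) :
    IsClosed (weakEmbed τ '' Metric.closedBall 0 C) := by
  have : T2Space (WeakBilin (topDualPairing ℂ S)) :=
    (WeakBilin.isEmbedding (injective_topDualPairing ℂ S)).t2Space
  exact (isCompact_weakEmbed_image_closedBall hτ C).isClosed

lemma mul_norm_le_of_forall_re_le {𝕜 V : Type*} [RCLike 𝕜] [NormedAddCommGroup V]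
    [NormedSpace 𝕜 V] {C r : ℝ} (hC : 0 ≤ C) (f : StrongDual 𝕜 V)
    (hf : ∀ z, ‖z‖ ≤ C → RCLike.re (f z) ≤ r) : C * ‖f‖ ≤ r := by
  have hr : 0 ≤ r := by simpa only [map_zero] using hf 0 (by rwa [norm_zero])
  rcases hC.eq_or_lt with rfl | hC
  · rwa [zero_mul]
  rw [mul_comm, ← le_div_iff₀ hC]
  refine f.opNorm_le_bound' (by positivity) fun z hz => ?_
  obtain ⟨c, hc, hcz⟩ := RCLike.exists_norm_eq_mul_self (f z)
  have hz' : 0 < ‖z‖ := (norm_nonneg z).lt_of_ne' hz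
  have h := hf (((C / ‖z‖ : ℝ) * c : 𝕜) • z) (by
    rw [norm_smul, norm_mul, hc, RCLike.norm_of_nonneg (by positivity)]
    field_simp
    exact le_rfl)
  rw [map_smul, smul_eq_mul, mul_assoc, ← hcz, RCLike.re_ofReal_mul, RCLike.ofReal_re] at h
  rw [div_mul_eq_mul_div, le_div_iff₀ hC]
  rwa [div_mul_eq_mul_div, div_le_iff₀ hz', mul_comm] at h

/-- The dual of `L₁(M, τ)` is `M`. -/
lemma exists_eq_trace_mul {τ : TracialState S} (hτ : τ.IsNormal) {C : ℝ} (hC : 0 ≤ C)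
    (φ : StrongDual ℂ S) (hφ : ∀ z : S, ‖φ z‖ ≤ C * ‖embed τ z‖) :
    ∃ h : S, ‖h‖ ≤ C ∧ ∀ z : S, φ z = τ.toFunctional (h * z) := by
  suffices hmem : (φ : WeakBilin (topDualPairing ℂ S)) ∈ weakEmbed τ '' Metric.closedBall 0 C by
    obtain ⟨h, hh, rfl⟩ := hmem
    exact ⟨h, mem_closedBall_zero_iff.mp hh, fun z => rfl⟩
  by_contra hmem
  have hconv : Convex ℝ (weakEmbed τ '' Metric.closedBall 0 C) :=
    (convex_closedBall (0 : S) C).linear_image ((weakEmbed τ).restrictScalars ℝ)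
  obtain ⟨f, r, hball, hr⟩ := RCLike.geometric_hahn_banach_closed_point (𝕜 := ℂ) hconv
    (isClosed_weakEmbed_image_closedBall hτ C) hmem
  obtain ⟨x, rfl⟩ := LinearMap.dualEmbedding_surjective (topDualPairing ℂ S) f
  have hle : C * ‖embed τ x‖ ≤ r := mul_norm_le_of_forall_re_le hC _ fun h hh => by
    rw [embed_apply, τ.comm']
    exact (hball _ ⟨h, mem_closedBall_zero_iff.mpr hh, rfl⟩).le
  have hlt : r < (φ x).re := hr
  exact absurd ((hlt.trans_le (Complex.re_le_norm _)).trans_le (hφ x)) hle.not_gt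

end Compactness

section Commutant

variable {H : Type u} [NormedAddCommGroup H] [InnerProductSpace ℂ H] [CompleteSpace H]
  {S : VonNeumannAlgebra H} {τ : TracialState S}

lemma inner_toL2_one_apply_toL2_mul {T : L2 τ →L[ℂ] L2 τ}
    (hT : ∀ y, T ∘L rightMul τ y = rightMul τ y ∘L T) (x y : S) :
    ⟪toL2 τ 1, T (toL2 τ (x * y))⟫_ℂ = ⟪toL2 τ (star y), T (toL2 τ x)⟫_ℂ := by
  rw [← rightMul_toL2, ← ContinuousLinearMap.comp_apply T, hT, ContinuousLinearMap.comp_apply,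
    inner_rightMul_right, rightMul_toL2, one_mul]

lemma norm_inner_toL2_one_apply_toL2_le {T : L2 τ →L[ℂ] L2 τ}
    (hT : ∀ y, T ∘L rightMul τ y = rightMul τ y ∘L T) (z : S) :
    ‖⟪toL2 τ 1, T (toL2 τ z)⟫_ℂ‖ ≤ ‖T‖ * ‖embed τ z‖ := by
  have hbound (ε : ℝ) (hε : 0 < ε) :
      ‖⟪toL2 τ 1, T (toL2 τ z)⟫_ℂ‖ ≤ ‖T‖ * (‖embed τ z‖ + ε) := by
    obtain ⟨x, y, rfl, hx, hy⟩ := exists_eq_mul_norm_sq_le τ z hε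
    rw [inner_toL2_one_apply_toL2_mul hT]
    calc ‖⟪toL2 τ (star y), T (toL2 τ x)⟫_ℂ‖
        ≤ ‖toL2 τ (star y)‖ * ‖T (toL2 τ x)‖ := norm_inner_le_norm _ _
      _ ≤ ‖toL2 τ y‖ * (‖T‖ * ‖toL2 τ x‖) := by
        rw [norm_toL2_star]
        gcongr
        exact T.le_opNorm _
      _ = ‖T‖ * (‖toL2 τ x‖ * ‖toL2 τ y‖) := by ring
      _ ≤ ‖T‖ * (‖embed τ (x * y)‖ + ε) := by
        gcongr
        nlinarith only [hx, hy, sq_nonneg (‖toL2 τ x‖ - ‖toL2 τ y‖)]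
  have hlim : Filter.Tendsto (fun ε : ℝ => ‖T‖ * (‖embed τ z‖ + ε)) (nhdsWithin 0 (Set.Ioi 0))
      (nhds (‖T‖ * (‖embed τ z‖ + 0))) :=
    (Continuous.tendsto (by fun_prop) 0).mono_left nhdsWithin_le_nhds
  rw [add_zero] at hlim
  exact ge_of_tendsto hlim (Filter.eventually_of_mem self_mem_nhdsWithin hbound)

lemma exists_leftMul_eq (hτ : τ.IsNormal) {T : L2 τ →L[ℂ] L2 τ}
    (hT : ∀ y, T ∘L rightMul τ y = rightMul τ y ∘L T) : ∃ h : S, ‖h‖ ≤ ‖T‖ ∧ leftMul τ h = T := by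
  let φ : StrongDual ℂ S := innerSL ℂ (toL2 τ 1) ∘L T ∘L
    (toL2 τ).mkContinuous 1 fun x => by simpa only [one_mul] using norm_toL2_le τ x
  have hφ (x : S) : φ x = ⟪toL2 τ 1, T (toL2 τ x)⟫_ℂ := rfl
  obtain ⟨h, hh, hφh⟩ := exists_eq_trace_mul hτ (norm_nonneg T) φ
    (norm_inner_toL2_one_apply_toL2_le hT)
  refine ⟨h, hh, ?_⟩
  ext ξ
  induction ξ using L2.induction_on with
  | isClosed =>
    exact isClosed_eq (ContinuousLinearMap.continuous _) (ContinuousLinearMap.continuous _)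
  | toL2 y =>
    refine (denseRange_toL2 τ).eq_of_inner_right ℂ fun x => ?_
    have hTxy := inner_toL2_one_apply_toL2_mul hT y (star x)
    rw [star_star] at hTxy
    rw [← hTxy, ← hφ, hφh, leftMul_toL2, inner_toL2, τ.comm' (star x), mul_assoc]

end Commutant

section Domination

variable {M : Type u} [CStarAlgebra M]

/-- The sesquilinear form `u (x* y)` is dominated by the quadratic form `g (x* x)`.  For
functionals of the form `g = ⟪ξ, · ξ⟫` this is the property that makes `u` factor through `ξ`, and,
unlike an order relation, it makes sense for functionals `u` that are not self-adjoint. -/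
def IsDominated (u g : StrongDual ℂ M) : Prop :=
  ∀ x y : M, ‖u (star x * y)‖ ≤ √(g (star x * x)).re * √(g (star y * y)).re

lemma sqrt_mul_sqrt_add_le {a b c d : ℝ} (ha : 0 ≤ a) (hb : 0 ≤ b) (hc : 0 ≤ c) (hd : 0 ≤ d) :
    √a * √b + √c * √d ≤ √(a + c) * √(b + d) := by
  rw [← Real.sqrt_mul (add_nonneg ha hc)]
  refine Real.le_sqrt_of_sq_le ?_
  calc (√a * √b + √c * √d) ^ 2
      ≤ (√a ^ 2 + √c ^ 2) * (√b ^ 2 + √d ^ 2) := by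
        linarith [sq_nonneg (√a * √d - √c * √b)]
    _ = (a + c) * (b + d) := by
        rw [Real.sq_sqrt ha, Real.sq_sqrt hb, Real.sq_sqrt hc, Real.sq_sqrt hd]

lemma IsDominated.add {u₁ u₂ g₁ g₂ : StrongDual ℂ M} (h₁ : IsDominated u₁ g₁)
    (h₂ : IsDominated u₂ g₂) (hg₁ : IsPos g₁) (hg₂ : IsPos g₂) :
    IsDominated (u₁ + u₂) (g₁ + g₂) := fun x y =>
  calc ‖(u₁ + u₂) (star x * y)‖ ≤ ‖u₁ (star x * y)‖ + ‖u₂ (star x * y)‖ := norm_add_le _ _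
    _ ≤ √(g₁ (star x * x)).re * √(g₁ (star y * y)).re +
          √(g₂ (star x * x)).re * √(g₂ (star y * y)).re := add_le_add (h₁ x y) (h₂ x y)
    _ ≤ _ := sqrt_mul_sqrt_add_le (hg₁.re_nonneg x) (hg₁.re_nonneg y) (hg₂.re_nonneg x)
      (hg₂.re_nonneg y)

lemma IsDominated.smul {u g : StrongDual ℂ M} (h : IsDominated u g) {c : ℂ} (hc : ‖c‖ ≤ 1) :
    IsDominated (c • u) g := fun x y =>
  calc ‖(c • u) (star x * y)‖ = ‖c‖ * ‖u (star x * y)‖ := norm_smul c _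
    _ ≤ ‖u (star x * y)‖ := mul_le_of_le_one_left (norm_nonneg _) hc
    _ ≤ _ := h x y

lemma IsDominated.mono {u g g' : StrongDual ℂ M} (h : IsDominated u g)
    (hg : ∀ x, (g (star x * x)).re ≤ (g' (star x * x)).re) : IsDominated u g' := fun x y =>
  (h x y).trans (mul_le_mul (Real.sqrt_le_sqrt (hg x)) (Real.sqrt_le_sqrt (hg y))
    (Real.sqrt_nonneg _) (Real.sqrt_nonneg _))

lemma isDominated_of_isPos {u g : StrongDual ℂ M} (hsub : IsPos (g - u)) (hadd : IsPos (g + u)) :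
    IsDominated u g := fun x y => by
  have add_re (z : M) : ((g + u) (star z * z)).re + ((g - u) (star z * z)).re =
      2 * (g (star z * z)).re := by
    simp only [_root_.add_apply, _root_.sub_apply, Complex.add_re, Complex.sub_re]
    ring
  have two_mul_norm : 2 * ‖u (star x * y)‖ =
      ‖(g + u) (star x * y) - (g - u) (star x * y)‖ := by
    rw [_root_.add_apply, _root_.sub_apply, add_sub_sub_cancel, ← two_mul, norm_mul,
      Complex.norm_ofNat]
  refine le_of_mul_le_mul_left ?_ (zero_lt_two' ℝ)
  calc 2 * ‖u (star x * y)‖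
      ≤ ‖(g + u) (star x * y)‖ + ‖(g - u) (star x * y)‖ := two_mul_norm ▸ norm_sub_le _ _
    _ ≤ √((g + u) (star x * x)).re * √((g + u) (star y * y)).re +
          √((g - u) (star x * x)).re * √((g - u) (star y * y)).re :=
        add_le_add (hadd.norm_apply_star_mul_le x y) (hsub.norm_apply_star_mul_le x y)
    _ ≤ √(2 * (g (star x * x)).re) * √(2 * (g (star y * y)).re) := by
        rw [← add_re, ← add_re]
        exact sqrt_mul_sqrt_add_le (hadd.re_nonneg x) (hadd.re_nonneg y) (hsub.re_nonneg x)
          (hsub.re_nonneg y)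
    _ = 2 * (√(g (star x * x)).re * √(g (star y * y)).re) := by
        rw [Real.sqrt_mul zero_le_two, Real.sqrt_mul zero_le_two, mul_mul_mul_comm,
          Real.mul_self_sqrt zero_le_two]

lemma compress_apply (p : M) (f : StrongDual ℂ M) (x : M) : compress p f x = f (p * x * p) := rfl

lemma IsDominated.compress {u g : StrongDual ℂ M} (h : IsDominated u g) {p : M}
    (hp : IsSelfAdjoint p) : IsDominated (compress p u) (compress p g) := fun x y => by
  have conj_eq (x y : M) : p * (star x * y) * p = star (x * p) * (y * p) := by
    rw [star_mul, hp.star_eq]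
    simp only [mul_assoc]
  simp only [compress_apply, conj_eq]
  exact h (x * p) (y * p)

end Domination

section MaximalNorm

variable {M : Type u} [CStarAlgebra M] {τ : TracialState M} {ι : Type*}

lemma exists_mul_sq_le_of_mul_lt {s t c : ℝ} (hs : 0 ≤ s) (ht : 0 ≤ t) (h : s * t < c) :
    ∃ r > 0, (r * s) ^ 2 ≤ c ∧ (r⁻¹ * t) ^ 2 ≤ c := by
  have hlim : Filter.Tendsto (fun ε => (s + ε) * (t + ε)) (nhdsWithin 0 (Set.Ioi 0))
      (nhds ((s + 0) * (t + 0))) :=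
    (Continuous.tendsto (by fun_prop) 0).mono_left nhdsWithin_le_nhds
  simp only [add_zero] at hlim
  obtain ⟨ε, hεc, hε : 0 < ε⟩ :=
    ((hlim.eventually_lt_const h).and self_mem_nhdsWithin).exists
  refine ⟨√((t + ε) / (s + ε)), by positivity, ?_, ?_⟩
  · rw [mul_pow, Real.sq_sqrt (by positivity)]
    calc (t + ε) / (s + ε) * s ^ 2 ≤ (t + ε) / (s + ε) * (s + ε) ^ 2 := by gcongr; linarith
      _ = (s + ε) * (t + ε) := by field_simp
      _ ≤ c := hεc.le
  · rw [mul_pow, inv_pow, Real.sq_sqrt (by positivity), inv_div]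
    calc (s + ε) / (t + ε) * t ^ 2 ≤ (s + ε) / (t + ε) * (t + ε) ^ 2 := by gcongr; linarith
      _ = (s + ε) * (t + ε) := by field_simp
      _ ≤ c := hεc.le

lemma exists_norm_le_mul_of_maxNorm_lt {u : ι → StrongDual ℂ M} {c : ℝ}
    (hc : maxNorm τ u < ENNReal.ofReal c) :
    ∃ a b : L2 τ, ‖a‖ * ‖b‖ < c ∧
      ∀ i x, ‖u i (star x * x)‖ ≤ ‖rightMul τ (star x) a‖ * ‖rightMul τ (star x) b‖ := by
  simp only [maxNorm, iInf_lt_iff] at hc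
  obtain ⟨a, b, h, ⟨R, hR⟩, hfac, hlt⟩ := hc
  have hsup : (⨆ i, ‖h i‖ₑ) ≠ ∞ := by
    refine ne_top_of_le_ne_top (ENNReal.ofReal_ne_top (r := R)) (iSup_le fun i => ?_)
    rw [← ofReal_norm]
    exact ENNReal.ofReal_le_ofReal (hR ⟨i, rfl⟩)
  set s : ℝ := (⨆ i, ‖h i‖ₑ).toReal
  have hs : 0 ≤ s := ENNReal.toReal_nonneg
  have hhs (i : ι) : ‖h i‖ ≤ s := by
    rw [← toReal_enorm]
    exact ENNReal.toReal_mono hsup (le_iSup (fun i => ‖h i‖ₑ) i)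
  have hnorm : ‖(s : ℂ) • b‖ = s * ‖b‖ := by
    rw [norm_smul, Complex.norm_of_nonneg hs]
  refine ⟨a, (s : ℂ) • b, ?_, fun i x => ?_⟩
  · rw [← ENNReal.ofReal_toReal hsup, ← ofReal_norm, ← ofReal_norm,
      ← ENNReal.ofReal_mul (norm_nonneg _), ← ENNReal.ofReal_mul (by positivity)] at hlt
    rw [hnorm, ← mul_assoc]
    exact (ENNReal.ofReal_lt_ofReal_iff'.mp hlt).1
  · rw [hfac, rightMul_mul, leftMul_rightMul, inner_rightMul_right, map_smul, norm_smul,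
      Complex.norm_of_nonneg hs]
    refine (norm_inner_le_norm _ _).trans ?_
    gcongr
    exact (norm_leftMul_apply_le τ _ _).trans (by gcongr; exact hhs i)

lemma exists_balanced_norm_le_of_maxNorm_lt {u : ι → StrongDual ℂ M} {c : ℝ}
    (hc : maxNorm τ u < ENNReal.ofReal c) :
    ∃ a b : L2 τ, ‖a‖ ^ 2 ≤ c ∧ ‖b‖ ^ 2 ≤ c ∧
      ∀ i x, ‖u i (star x * x)‖ ≤ ‖rightMul τ (star x) a‖ * ‖rightMul τ (star x) b‖ := by
  obtain ⟨a, b, hab, hu⟩ := exists_norm_le_mul_of_maxNorm_lt hc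
  obtain ⟨r, hr, ha, hb⟩ := exists_mul_sq_le_of_mul_lt (norm_nonneg a) (norm_nonneg b) hab
  refine ⟨(r : ℂ) • a, ((r⁻¹ : ℝ) : ℂ) • b, ?_, ?_, fun i x => (hu i x).trans_eq ?_⟩
  · rwa [norm_smul, Complex.norm_of_nonneg hr.le]
  · rwa [norm_smul, Complex.norm_of_nonneg (inv_nonneg.mpr hr.le)]
  · rw [map_smul, map_smul, norm_smul, norm_smul, Complex.norm_of_nonneg hr.le,
      Complex.norm_of_nonneg (inv_nonneg.mpr hr.le), mul_mul_mul_comm, mul_inv_cancel₀ hr.ne',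
      one_mul]

lemma IsPos.sub_and_add_of_norm_le {u g : StrongDual ℂ M} (hg : IsPos g)
    (hu : ∀ x, (u (star x * x)).im = 0)
    (hug : ∀ x, ‖u (star x * x)‖ ≤ (g (star x * x)).re) : IsPos (g - u) ∧ IsPos (g + u) := by
  have him (x : M) : (g (star x * x)).im = 0 := (Complex.le_def.mp (hg x)).2.symm
  have hre (x : M) := abs_le.mp ((Complex.abs_re_le_norm _).trans (hug x))
  refine ⟨fun x => ?_, fun x => ?_⟩
  · rw [_root_.sub_apply, sub_nonneg, Complex.le_def, hu, him]
    exact ⟨(hre x).2, rfl⟩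
  · rw [_root_.add_apply, Complex.le_def, Complex.add_re, Complex.add_im, hu, him, add_zero]
    exact ⟨by rw [Complex.zero_re]; linarith [(hre x).1], rfl⟩

lemma exists_majorant_of_maxNorm_lt {v : ι → L1 τ} (hv : ∀ i, (v i).IsSA) {C : ℝ≥0∞}
    (hC : maxNorm τ (fun i => (v i).toDual) < C) :
    ∃ g : L1 τ, ‖g‖ₑ ≤ C ∧ IsPos g.toDual ∧
      ∀ i, IsPos (g - v i).toDual ∧ IsPos (g + v i).toDual := by
  obtain ⟨c, -, hvc, hcC⟩ := ENNReal.lt_iff_exists_real_btwn.mp hC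
  obtain ⟨a, b, ha, hb, hab⟩ := exists_balanced_norm_le_of_maxNorm_lt hvc
  obtain ⟨P, hP⟩ := exists_toDual_eq_vectorFunctional τ a
  obtain ⟨Q, hQ⟩ := exists_toDual_eq_vectorFunctional τ b
  have hPQ (x : M) : (((2⁻¹ : ℂ) • (P + Q)).toDual (star x * x)) =
      ((2⁻¹ * (‖rightMul τ (star x) a‖ ^ 2 + ‖rightMul τ (star x) b‖ ^ 2) : ℝ) : ℂ) := by
    rw [L1.toDual_smul, L1.toDual_add, hP, hQ, _root_.smul_apply, _root_.add_apply,
      vectorFunctional_star_mul_self, vectorFunctional_star_mul_self]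
    push_cast
    rfl
  have hpos : IsPos ((2⁻¹ : ℂ) • (P + Q)).toDual := fun x => by
    rw [hPQ]
    exact Complex.zero_le_real.mpr (by positivity)
  refine ⟨(2⁻¹ : ℂ) • (P + Q), ?_, hpos, fun i => ?_⟩
  · have hP' : ‖P‖ ≤ c := by
      rw [← L1.norm_toDual, hP]
      exact (norm_vectorFunctional_le τ a).trans ha
    have hQ' : ‖Q‖ ≤ c := by
      rw [← L1.norm_toDual, hQ]
      exact (norm_vectorFunctional_le τ b).trans hb
    rw [← ofReal_norm]
    refine (ENNReal.ofReal_le_ofReal ?_).trans hcC.le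
    rw [norm_smul, norm_inv, Complex.norm_ofNat]
    linarith [norm_add_le P Q]
  · rw [L1.toDual_sub, L1.toDual_add]
    refine hpos.sub_and_add_of_norm_le (hv i).im_apply_star_mul_self fun x => ?_
    rw [hPQ, Complex.ofReal_re]
    linarith [hab i x, two_mul_le_add_sq ‖rightMul τ (star x) a‖ ‖rightMul τ (star x) b‖]

end MaximalNorm

section Limsup

variable {M : Type u} [CStarAlgebra M] (τ : TracialState M)

lemma compress_embed (p z : M) : compress p (embed τ z) = embed τ (p * z * p) := by
  ext x
  rw [compress_apply, embed_apply, embed_apply, ← mul_assoc, τ.comm' _ p]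
  simp only [mul_assoc]

lemma compress_sub (p : M) (f g : StrongDual ℂ M) :
    compress p (f - g) = compress p f - compress p g :=
  ContinuousLinearMap.sub_comp f g _

lemma norm_compress_le {p : M} (hp : ‖p‖ ≤ 1) (f : StrongDual ℂ M) : ‖compress p f‖ ≤ ‖f‖ :=
  ContinuousLinearMap.opNorm_le_bound _ (norm_nonneg f) fun x => by
    refine f.le_opNorm_of_le ?_
    calc ‖p * x * p‖ ≤ ‖p‖ * ‖x‖ * ‖p‖ := norm_mul₃_le
      _ ≤ 1 * ‖x‖ * 1 := by gcongr
      _ = ‖x‖ := by ring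

variable {τ} in
lemma L1.exists_toDual_eq_compress (p : M) (f : L1 τ) :
    ∃ g : L1 τ, g.toDual = compress p f.toDual := by
  refine L1.exists_toDual_eq (map_mem_closure (continuous_id.clm_comp_const _) f.toDual_mem ?_)
  rintro _ ⟨z, rfl⟩
  exact ⟨p * z * p, (compress_embed τ p z).symm⟩

lemma norm_trace_mul_star_mul_self_le (z x : M) :
    ‖τ.toFunctional (z * (star x * x))‖ ≤ ‖z‖ * (τ.toFunctional (star x * x)).re :=
  calc ‖τ.toFunctional (z * (star x * x))‖ = ‖⟪toL2 τ (star x), toL2 τ (z * star x)⟫_ℂ‖ := by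
        rw [inner_toL2, star_star, τ.comm' x, mul_assoc]
    _ ≤ ‖toL2 τ (star x)‖ * (‖z‖ * ‖toL2 τ (star x)‖) :=
        (norm_inner_le_norm _ _).trans (by gcongr; exact norm_toL2_mul_le τ z (star x))
    _ = ‖z‖ * (τ.toFunctional (star x * x)).re := by
        rw [norm_toL2_star, ← norm_sq_toL2]
        ring

lemma re_apply_star_mul_self_le_of_normInfty_lt {u v : StrongDual ℂ M} {η : ℝ}
    (h : normInfty τ (u - v) < ENNReal.ofReal η) (x : M) :
    (u (star x * x)).re ≤ (v (star x * x)).re + η * (τ.toFunctional (star x * x)).re := by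
  simp only [normInfty, iInf_lt_iff] at h
  obtain ⟨z, hz, hzη⟩ := h
  rw [← ofReal_norm, ENNReal.ofReal_lt_ofReal_iff'] at hzη
  have huv : u (star x * x) - v (star x * x) = τ.toFunctional (z * (star x * x)) :=
    DFunLike.congr_fun hz (star x * x)
  have hre := (Complex.re_le_norm _).trans (norm_trace_mul_star_mul_self_le τ z x)
  rw [← huv, Complex.sub_re] at hre
  have hx : 0 ≤ (τ.toFunctional (star x * x)).re := by
    rw [← norm_sq_toL2]
    positivity
  linarith [mul_le_mul_of_nonneg_right hzη.1.le hx]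

lemma exists_vector_majorant_compress_add {p : M} (hp : ‖p‖ ≤ 1) (f : L1 τ) {δ : ℝ}
    (hδ : 0 < δ) :
    ∃ ξ : L2 τ, ‖ξ‖ ^ 2 ≤ ‖f‖ + δ ∧ ∃ η > 0, ∀ x,
      (compress p f.toDual (star x * x)).re + η * (τ.toFunctional (star x * x)).re ≤
        (vectorFunctional τ ξ (star x * x)).re := by
  have hη : 0 < δ / 2 := half_pos hδ
  obtain ⟨g, hg⟩ := L1.exists_toDual_eq_compress p f
  obtain ⟨t, ht⟩ := L1.exists_toDual_eq (τ := τ)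
    (Submodule.le_topologicalClosure _ (LinearMap.mem_range_self (embed τ) 1))
  have hgf : ‖g‖ ≤ ‖f‖ := by
    rw [← L1.norm_toDual, hg, ← L1.norm_toDual]
    exact norm_compress_le hp _
  have ht1 : ‖t‖ ≤ 1 := by
    rw [← L1.norm_toDual, ht]
    exact norm_embed_one_le τ
  have hnorm : ‖g + ((δ / 2 : ℝ) : ℂ) • t‖ ≤ ‖f‖ + δ / 2 := by
    refine norm_add_le_of_le hgf ?_
    rw [norm_smul, Complex.norm_of_nonneg hη.le]
    exact mul_le_of_le_one_right hη.le ht1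
  obtain ⟨ξ, hξ, hmaj⟩ := exists_vector_majorant τ (g + ((δ / 2 : ℝ) : ℂ) • t) hη
  refine ⟨ξ, by linarith, δ / 2, hη, fun x => ?_⟩
  have h := hmaj x
  rwa [L1.toDual_add, L1.toDual_smul, hg, ht, _root_.add_apply, _root_.smul_apply, smul_eq_mul,
    Complex.add_re, Complex.re_ofReal_mul, embed_apply, one_mul,
    ← re_vectorFunctional_star_mul_self] at h

lemma maxNorm_le_of_forall_eq {ι : Type*} {u : ι → StrongDual ℂ M} {ξ : L2 τ} {h : ι → M}
    (hh : ∀ i, ‖h i‖ ≤ 1) (hu : ∀ i x, u i x = ⟪ξ, leftMul τ (h i) (rightMul τ x ξ)⟫_ℂ) :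
    maxNorm τ u ≤ ENNReal.ofReal (‖ξ‖ ^ 2) := by
  have hbdd : BddAbove (Set.range fun i => ‖h i‖) := ⟨1, Set.forall_mem_range.mpr hh⟩
  have hsup : ⨆ i, ‖h i‖ₑ ≤ 1 := iSup_le fun i => by
    rw [← ofReal_norm]
    exact ENNReal.ofReal_le_one.mpr (hh i)
  calc maxNorm τ u ≤ ‖ξ‖ₑ * (⨆ i, ‖h i‖ₑ) * ‖ξ‖ₑ :=
        iInf₂_le_of_le ξ ξ (iInf_le_of_le h (iInf₂_le hbdd hu))
    _ ≤ ‖ξ‖ₑ * 1 * ‖ξ‖ₑ := by gcongr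
    _ = ENNReal.ofReal (‖ξ‖ ^ 2) := by
      rw [mul_one, ← sq, ENNReal.ofReal_pow (norm_nonneg ξ), ofReal_norm]

variable {H : Type u} [NormedAddCommGroup H] [InnerProductSpace ℂ H] [CompleteSpace H]
  {S : VonNeumannAlgebra H} {τ : TracialState S}

lemma IsDominated.exists_eq_inner_leftMul (hτ : τ.IsNormal) {u : StrongDual ℂ S} {ξ : L2 τ}
    (hu : IsDominated u (vectorFunctional τ ξ)) :
    ∃ h : S, ‖h‖ ≤ 1 ∧ ∀ x, u x = ⟪ξ, leftMul τ h (rightMul τ x ξ)⟫_ℂ := by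
  obtain ⟨T, hT, hcomm, huT⟩ := exists_commuting_contraction τ u ξ fun x z => by
    have h := hu (star z) (star x)
    rwa [re_vectorFunctional_star_mul_self, re_vectorFunctional_star_mul_self,
      Real.sqrt_sq (norm_nonneg _), Real.sqrt_sq (norm_nonneg _), star_star, star_star,
      mul_comm ‖rightMul τ z ξ‖] at h
  obtain ⟨h, hh, rfl⟩ := exists_leftMul_eq hτ hcomm
  exact ⟨h, hh.trans hT, huT⟩

lemma maxNorm_le_of_isDominated (hτ : τ.IsNormal) {ι : Type*} {u : ι → StrongDual ℂ S}
    {ξ : L2 τ} (hu : ∀ i, IsDominated (u i) (vectorFunctional τ ξ)) :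
    maxNorm τ u ≤ ENNReal.ofReal (‖ξ‖ ^ 2) := by
  choose h hh huh using fun i => (hu i).exists_eq_inner_leftMul hτ
  exact maxNorm_le_of_forall_eq τ hh huh

lemma limsupNorm_le_of_tendstoBAU (hτ : τ.IsNormal) {u : ℕ → ℕ → L1 τ} {g : ℕ → L1 τ} {g₀ : L1 τ}
    (hu : ∀ n m, IsDominated (u n m).toDual (g n).toDual) (hg : TendstoBAU τ g g₀) :
    limsupNorm τ u ≤ ‖g₀‖ₑ := by
  refine iSup₂_le fun ε hε => ENNReal.le_of_forall_pos_le_add fun δ hδ _ => ?_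
  obtain ⟨e, he, hτe, hlim⟩ := hg ε hε
  obtain ⟨ξ, hξ, η, hη, hmaj⟩ := exists_vector_majorant_compress_add τ he.one_sub.norm_le g₀ hδ
  simp only [compress_sub] at hlim
  obtain ⟨N, hN⟩ := Filter.eventually_atTop.mp
    (hlim.eventually_lt_const (ENNReal.ofReal_pos.mpr hη))
  have hdom (n m : ℕ) (hn : N < n) :
      IsDominated (compress (1 - e) (u n m).toDual) (vectorFunctional τ ξ) :=
    ((hu n m).compress he.one_sub.isSelfAdjoint).mono fun x =>
      (re_apply_star_mul_self_le_of_normInfty_lt τ (hN n hn.le) x).trans (hmaj x)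
  refine iInf₂_le_of_le e he (iInf₂_le_of_le hτe N (iInf_le_of_le 0 ?_))
  calc _ ≤ ENNReal.ofReal (‖ξ‖ ^ 2) := maxNorm_le_of_isDominated hτ fun i => hdom _ _ i.1.2
    _ ≤ ENNReal.ofReal (‖g₀‖ + δ) := ENNReal.ofReal_le_ofReal hξ
    _ ≤ ENNReal.ofReal ‖g₀‖ + ENNReal.ofReal δ := ENNReal.ofReal_add_le
    _ = ‖g₀‖ₑ + δ := by rw [ofReal_norm, ENNReal.ofReal_coe_nnreal]

end Limsup

section MaximalInequality

lemma le_mul_add_of_forall_lt {a k s t : ℝ≥0∞} (hk : k ≠ ∞) (hs : s ≠ ∞) (ht : t ≠ ∞)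
    (h : ∀ s' > s, ∀ t' > t, a ≤ k * (s' + t')) : a ≤ k * (s + t) := by
  have hlim : Filter.Tendsto (fun δ : ℝ≥0∞ => k * ((s + δ) + (t + δ))) (nhdsWithin 0 (Set.Ioi 0))
      (nhds (k * ((s + 0) + (t + 0)))) :=
    (ENNReal.Tendsto.const_mul ((tendsto_const_nhds.add Filter.tendsto_id).add
      (tendsto_const_nhds.add Filter.tendsto_id)) (.inr hk)).mono_left nhdsWithin_le_nhds
  rw [add_zero, add_zero] at hlim
  refine ge_of_tendsto hlim (Filter.eventually_of_mem self_mem_nhdsWithin fun δ (hδ : 0 < δ) => ?_)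
  exact h _ (ENNReal.lt_add_right hs hδ.ne') _ (ENNReal.lt_add_right ht hδ.ne')

section CStarAlgebra

variable {M : Type u} [CStarAlgebra M] {τ : TracialState M}

lemma maxNorm_zero {ι : Type*} : maxNorm τ (fun _ : ι => (0 : StrongDual ℂ M)) = 0 := by
  refine le_antisymm ?_ zero_le
  calc maxNorm τ (fun _ : ι => (0 : StrongDual ℂ M))
      ≤ ‖(0 : L2 τ)‖ₑ * (⨆ _ : ι, ‖(0 : M)‖ₑ) * ‖(0 : L2 τ)‖ₑ :=
        iInf₂_le_of_le 0 0 (iInf₂_le_of_le 0 ⟨0, by simp [upperBounds]⟩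
          (iInf_le_of_le (by simp) le_rfl))
    _ = 0 := by rw [enorm_zero, mul_zero]

lemma maxNorm_le_maxOpNorm_mul {Φ : ℝ → ℝ} {B : ℕ → L1 τ →ₗ[ℂ] L1 τ}
    (hB : maxOpNorm τ Φ B < ∞) {f : L1 τ} (hf : orliczNorm τ Φ f < ∞) :
    maxNorm τ (fun m => (B m f).toDual) ≤ maxOpNorm τ Φ B * orliczNorm τ Φ f := by
  rcases eq_or_ne (orliczNorm τ Φ f) 0 with h0 | h0
  · obtain ⟨C, hC, -⟩ := sInf_lt_iff.mp hB
    have h := hC f hf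
    rwa [h0, mul_zero] at h ⊢
  · rw [← ENNReal.div_le_iff h0 hf.ne]
    exact le_sInf fun C hC => (ENNReal.div_le_iff h0 hf.ne).mpr (hC f hf)

lemma exists_comp_majorant_of_maxNorm_lt {A : ℕ → L1 τ →ₗ[ℂ] L1 τ}
    (hA : ∀ n, IsPositivityPreserving τ (A n)) {ι : Type*} {v : ι → L1 τ} (hv : ∀ i, (v i).IsSA)
    {C : ℝ≥0∞} (hC : maxNorm τ (fun i => (v i).toDual) < C) :
    ∃ g : L1 τ, ‖g‖ₑ ≤ C ∧
      ∀ n, IsPos (A n g).toDual ∧ ∀ i, IsDominated (A n (v i)).toDual (A n g).toDual := by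
  obtain ⟨g, hgC, hg, hgv⟩ := exists_majorant_of_maxNorm_lt hv hC
  refine ⟨g, hgC, fun n => ⟨hA n g hg, fun i => isDominated_of_isPos ?_ ?_⟩⟩
  · rw [← L1.toDual_sub, ← map_sub]
    exact hA n _ (hgv i).1
  · rw [← L1.toDual_add, ← map_add]
    exact hA n _ (hgv i).2

end CStarAlgebra

variable {H : Type u} [NormedAddCommGroup H] [InnerProductSpace ℂ H] [CompleteSpace H]
  {S : VonNeumannAlgebra H} {τ : TracialState S} {A : ℕ → L1 τ →ₗ[ℂ] L1 τ}
  {F : L1 τ →L[ℂ] L1 τ} {v w : ℕ → L1 τ}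

lemma limsupNorm_add_I_smul_le (hτ : τ.IsNormal) (hA : ∀ n, IsPositivityPreserving τ (A n))
    (hF : ∀ f, TendstoBAU τ (fun n => A n f) (F f))
    (hv : ∀ m, (v m).IsSA) (hw : ∀ m, (w m).IsSA)
    (hv' : maxNorm τ (fun m => (v m).toDual) ≠ ∞) (hw' : maxNorm τ (fun m => (w m).toDual) ≠ ∞) :
    limsupNorm τ (fun n m => A n (v m + Complex.I • w m)) ≤
      ‖F‖ₑ * (maxNorm τ (fun m => (v m).toDual) + maxNorm τ (fun m => (w m).toDual)) := by
  refine le_mul_add_of_forall_lt enorm_ne_top hv' hw' fun s hs t ht => ?_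
  obtain ⟨g, hg, hgv⟩ := exists_comp_majorant_of_maxNorm_lt hA hv hs
  obtain ⟨k, hk, hkw⟩ := exists_comp_majorant_of_maxNorm_lt hA hw ht
  have hdom (n m : ℕ) :
      IsDominated (A n (v m + Complex.I • w m)).toDual (A n (g + k)).toDual := by
    simp only [map_add, map_smul, L1.toDual_add, L1.toDual_smul]
    exact ((hgv n).2 m).add (((hkw n).2 m).smul Complex.norm_I.le) (hgv n).1 (hkw n).1
  calc _ ≤ ‖F (g + k)‖ₑ := limsupNorm_le_of_tendstoBAU hτ hdom (hF (g + k))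
    _ ≤ ‖F‖ₑ * (s + t) := F.le_opENorm_of_le ((enorm_add_le g k).trans (add_le_add hg hk))

lemma limsupNorm_le (hτ : τ.IsNormal) (hA : ∀ n, IsPositivityPreserving τ (A n))
    (hF : ∀ f, TendstoBAU τ (fun n => A n f) (F f)) (hv : ∀ m, (v m).IsSA)
    (hv' : maxNorm τ (fun m => (v m).toDual) ≠ ∞) :
    limsupNorm τ (fun n m => A n (v m)) ≤ ‖F‖ₑ * maxNorm τ (fun m => (v m).toDual) := by
  have hzero : maxNorm τ (fun _ : ℕ => (0 : L1 τ).toDual) = 0 := by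
    rw [L1.toDual_zero, maxNorm_zero]
  have isSA_zero : (0 : L1 τ).IsSA := fun x => by simp [L1.toDual_zero]
  have h := limsupNorm_add_I_smul_le hτ hA hF hv (w := fun _ => 0) (fun _ => isSA_zero) hv'
    (hzero ▸ ENNReal.zero_ne_top)
  simpa only [smul_zero, add_zero, hzero] using h

end MaximalInequality

end NCIntegration

end

theorem theoremA_general {H : Type*} [NormedAddCommGroup H] [InnerProductSpace ℂ H]
    [CompleteSpace H] (S : VonNeumannAlgebra H) (τ : NCIntegration.TracialState S)
    (hτn : τ.IsNormal) (p : NCIntegration.L1 τ → ℝ≥0∞) {C : ℝ≥0∞} (hC : C < ∞)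
    (A B : ℕ → NCIntegration.L1 τ →ₗ[ℂ] NCIntegration.L1 τ)
    (hA : ∀ n, NCIntegration.IsPositivityPreserving τ (A n))
    (hB : ∀ m (f : NCIntegration.L1 τ), f.IsSA → (B m f).IsSA)
    (hBmax : ∀ f, p f < ∞ → NCIntegration.maxNorm τ (fun m => (B m f).toDual) ≤ C * p f)
    (F : NCIntegration.L1 τ →L[ℂ] NCIntegration.L1 τ)
    (hF : ∀ f, NCIntegration.TendstoBAU τ (fun n => A n f) (F f)) :
    (∀ f : NCIntegration.L1 τ, f.IsSA → p f < ∞ →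
      NCIntegration.limsupNorm τ (fun n m => A n (B m f)) ≤ ‖F‖ₑ * C * p f) ∧
    (∀ f g h : NCIntegration.L1 τ, g.IsSA → h.IsSA → f = g + Complex.I • h →
      p g < ∞ → p h < ∞ →
      NCIntegration.limsupNorm τ (fun n m => A n (B m f)) ≤ ‖F‖ₑ * C * (p g + p h)) := by
  have hfin {f : NCIntegration.L1 τ} (hf : p f < ∞) :
      NCIntegration.maxNorm τ (fun m => (B m f).toDual) ≠ ∞ :=
    ((hBmax f hf).trans_lt (ENNReal.mul_lt_top hC hf)).ne
  refine ⟨fun f hfsa hf => ?_, fun f g h hgsa hhsa hfgh hg hh => ?_⟩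
  · rw [mul_assoc]
    exact (NCIntegration.limsupNorm_le hτn hA hF (hB · f hfsa) (hfin hf)).trans
      (mul_le_mul_right (hBmax f hf) _)
  · have hBf (m : ℕ) : B m f = B m g + Complex.I • B m h := by rw [hfgh, map_add, map_smul]
    simp only [hBf]
    rw [mul_assoc, mul_add]
    refine (NCIntegration.limsupNorm_add_I_smul_le hτn hA hF (hB · g hgsa) (hB · h hhsa) (hfin hg)
      (hfin hh)).trans ?_
    gcongr
    exacts [hBmax g hg, hBmax h hh]

theorem theoremA {H : Type*} [NormedAddCommGroup H] [InnerProductSpace ℂ H] [CompleteSpace H]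
    (S : VonNeumannAlgebra H) (τ : NCIntegration.TracialState S)
    (hτn : τ.IsNormal) (hτf : τ.IsFaithful)
    (Φ : ℝ → ℝ) (hΦ : NCIntegration.IsOrlicz Φ)
    (A B : ℕ → NCIntegration.L1 τ →ₗ[ℂ] NCIntegration.L1 τ)
    (hA : ∀ n, NCIntegration.IsPositivityPreserving τ (A n))
    (hB : ∀ m, NCIntegration.IsPositivityPreserving τ (B m))
    (hBmax : NCIntegration.maxOpNorm τ Φ B < ∞)
    (F : NCIntegration.L1 τ →L[ℂ] NCIntegration.L1 τ)
    (hF : ∀ f, NCIntegration.TendstoBAU τ (fun n => A n f) (F f)) :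
    (∀ f : NCIntegration.L1 τ, f.IsSA → NCIntegration.orliczNorm τ Φ f < ∞ →
      NCIntegration.limsupNorm τ (fun n m => A n (B m f)) ≤
        ‖F‖ₑ * NCIntegration.maxOpNorm τ Φ B * NCIntegration.orliczNorm τ Φ f) ∧
    (∀ f g h : NCIntegration.L1 τ, g.IsSA → h.IsSA → f = g + Complex.I • h →
      NCIntegration.orliczNorm τ Φ g < ∞ → NCIntegration.orliczNorm τ Φ h < ∞ →
      NCIntegration.limsupNorm τ (fun n m => A n (B m f)) ≤
        ‖F‖ₑ * NCIntegration.maxOpNorm τ Φ B *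
          (NCIntegration.orliczNorm τ Φ g + NCIntegration.orliczNorm τ Φ h)) :=
  theoremA_general S τ hτn (NCIntegration.orliczNorm τ Φ) hBmax A B hA (fun m _ => (hB m).isSA)
    (fun _ => NCIntegration.maxNorm_le_maxOpNorm_mul hBmax) F hF
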